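/- **Proposition 2.2.** Let $\Gamma_0$ be a discrete abelian group, let $B$ be a (finite) von Neumann algebra acting on a Hilbert space $H$, let $\tau$ be a trace on $B$, i.e. a normal, faithful, positive linear functional with $\tau(xy)=\tau(yx)$ and $\tau(1)=1$, and let $\alpha$ be an action of $\Gamma_0$ on $B$ by $*$-automorphisms with $\tau\circ\alpha_g=\tau$ for all $g\in\Gamma_0$. Let $M=B\rtimes_\alpha\Gamma_0$ be the crossed product, i.e. the von Neumann algebra on $\ell^2(\Gamma_0,H)$ generated by the operators $(\pi(b)\xi)(g)=\alpha_{g^{-1}}(b)\xi(g)$ for $b\in B$ and $(\lambda(h)\xi)(g)=\xi(h^{-1}g)$ for $h\in\Gamma_0$, with the trace, again denoted $\tau$, that extends the trace of $B$ by $\tau\big(\sum_\gamma \pi(b_\gamma)\lambda(\gamma)\big)=\tau(b_1)$. Put $\Vert x\Vert_2=\tau(x^*x)^{1/2}$ for $x\in M$. Let $A=L(\Gamma_0)\subset M$ be the abelian von Neumann subalgebra generated by $\lambda(\Gamma_0)$, and let $E_A:M\to A$ be the $\tau$-preserving conditional expectation, characterised by $E_A(x)\in A$ and $\tau(E_A(x)a)=\tau(xa)$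 for all $x\in M$, $a\in A$. Then the following are equivalent: 1. $A$ is weakly mixing in $M$: there is a subgroup $G$ of the unitary group $U(A)$ such that for every finite set $F\subset\{x\in M: E_A(x)=0\}$ and every $\varepsilon>0$ there is $v\in G$ with $\Vert E_A(x^*vyv^*)\Vert_2\le\varepsilon$ for all $x,y\in F$. 2. The action $\alpha$ is weakly mixing: for every finite set $F\subset B$ and every $\varepsilon>0$ there is $g\in\Gamma_0$ with $|\tau(\alpha_g(a)b)-\tau(a)\tau(b)|<\varepsilon$ for all $a,b\in F$. -/

import Mathlib

open scoped ENNReal ComplexOrder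

noncomputable section

/-! ### Weak mixing of actions and of subalgebras

The definitions of this first part only involve the `*`-algebra `M` and its trace `τ`. -/

section Mixing

variable {M : Type*} [Ring M] [StarRing M] [Algebra ℂ M] [StarModule ℂ M]

/-- The norm `‖x‖₂ = τ(x* x)^{1/2}` attached to a trace `τ`. -/
def twoNorm (τ : M →ₗ[ℂ] ℂ) (x : M) : ℝ := Real.sqrt (τ (star x * x)).re

/-- The map `α` preserves `τ`: `τ(α_g(x)) = τ(x)`. -/
def PreservesTrace {Γ : Type*} [Group Γ] (τ : M →ₗ[ℂ] ℂ) (α : Γ →* (M ≃⋆ₐ[ℂ] M)) : Prop :=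
  ∀ g x, τ (α g x) = τ x

/-- A trace-preserving action `α` of `Γ` on `M` is *weakly mixing* if for every finite set
`F ⊆ M` and every `ε > 0` there is `g` with `|τ(α_g(a) b) - τ(a) τ(b)| < ε` for all `a, b ∈ F`. -/
def IsWeaklyMixingAction {Γ : Type*} [Group Γ] (τ : M →ₗ[ℂ] ℂ) (α : Γ →* (M ≃⋆ₐ[ℂ] M)) : Prop :=
  ∀ F : Finset M, ∀ ε : ℝ, 0 < ε → ∃ g : Γ, ∀ a ∈ F, ∀ b ∈ F, ‖τ (α g a * b) - τ a * τ b‖ < ε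

/-- `E` is the `τ`-preserving conditional expectation of `M` onto `A`: `E(x) ∈ A` and
`τ(E(x) a) = τ(x a)` for all `x ∈ M` and `a ∈ A`. These conditions determine `E` uniquely
when `τ` is a faithful trace. -/
def IsConditionalExpectation (τ : M →ₗ[ℂ] ℂ) (A : StarSubalgebra ℂ M) (E : M → M) : Prop :=
  ∀ x : M, E x ∈ A ∧ ∀ a ∈ A, τ (E x * a) = τ (x * a)

/-- Relative weak mixing: an action `σ` of `G` on `M` (leaving `A` globally
invariant) is *weakly mixing relative to* `A` if for every finite set `F` in
`M ⊖ A = {x | E_A(x) = 0}` and every `ε > 0` there is `g` such that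
`‖E_A(x* σ_g(y))‖₂ ≤ ε` for all `x, y ∈ F`. -/
def IsWeaklyMixingRelativeTo {G : Type*} [Group G] (τ : M →ₗ[ℂ] ℂ) (A : StarSubalgebra ℂ M)
    (σ : G →* (M ≃⋆ₐ[ℂ] M)) : Prop :=
  (∀ g, ∀ x, σ g x ∈ A ↔ x ∈ A) ∧
  ∃ E : M → M, IsConditionalExpectation τ A E ∧
    ∀ F : Finset M, (∀ x ∈ F, E x = 0) → ∀ ε : ℝ, 0 < ε →
      ∃ g : G, ∀ x ∈ F, ∀ y ∈ F, twoNorm τ (E (star x * σ g y)) ≤ ε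

/-- `A` is *weakly mixing in* `M` if there is a subgroup `G` of the unitary group `U(A)` whose
action on `M` by conjugation `σ_v(x) = v x v*` is weakly mixing relative to `A`. -/
def IsWeaklyMixingIn (τ : M →ₗ[ℂ] ℂ) (A : StarSubalgebra ℂ M) : Prop :=
  ∃ G : Subgroup (unitary M), (∀ v ∈ G, (v : M) ∈ A) ∧
    IsWeaklyMixingRelativeTo τ A ((Unitary.conjStarAlgAut ℂ M).comp G.subtype)

end Mixing

/-! ### Von Neumann algebras -/

section VN

variable {H : Type*} [NormedAddCommGroup H] [InnerProductSpace ℂ H] [CompleteSpace H]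

/-- The von Neumann algebra generated by a set of operators: the bicommutant of
`S ∪ S*`. -/
def vonNeumannGenerated (S : Set (H →L[ℂ] H)) : VonNeumannAlgebra H where
  toStarSubalgebra := StarSubalgebra.centralizer ℂ (StarSubalgebra.centralizer ℂ S : Set (H →L[ℂ] H))
  centralizer_centralizer' := by
    change Set.centralizer (Set.centralizer ((StarSubalgebra.centralizer ℂ
      (StarSubalgebra.centralizer ℂ S : Set (H →L[ℂ] H)) : StarSubalgebra ℂ (H →L[ℂ] H)) :
        Set (H →L[ℂ] H))) = ((StarSubalgebra.centralizer ℂ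
      (StarSubalgebra.centralizer ℂ S : Set (H →L[ℂ] H)) : StarSubalgebra ℂ (H →L[ℂ] H)) :
        Set (H →L[ℂ] H))
    rw [StarSubalgebra.coe_centralizer_centralizer, Set.centralizer_centralizer_centralizer]

theorem coe_vonNeumannGenerated (S : Set (H →L[ℂ] H)) :
    ((vonNeumannGenerated S).toStarSubalgebra : Set (H →L[ℂ] H)) =
      (S ∪ star S).centralizer.centralizer :=
  StarSubalgebra.coe_centralizer_centralizer ℂ S

/-- A *trace* on the von Neumann algebra `B ⊆ B(H)` in the sense used here: a normal, faithful,
positive, tracial linear functional with `τ(1) = 1`. Normality is ultraweak continuity, i.e. `τ`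
has the form `x ↦ ∑ₙ ⟨x ξₙ, ηₙ⟩` with `∑ ‖ξₙ‖² < ∞` and `∑ ‖ηₙ‖² < ∞`. -/
structure IsNormalFaithfulTrace (B : VonNeumannAlgebra H) (τ : B.toStarSubalgebra →ₗ[ℂ] ℂ) :
    Prop where
  map_one : τ 1 = 1
  nonneg : ∀ x, 0 ≤ τ (star x * x)
  faithful : ∀ x, τ (star x * x) = 0 → x = 0
  tracial : ∀ x y, τ (x * y) = τ (y * x)
  normal : ∃ ξ η : ℕ → H, Summable (fun n => ‖ξ n‖ ^ 2) ∧ Summable (fun n => ‖η n‖ ^ 2) ∧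
    ∀ x : B.toStarSubalgebra, HasSum (fun n => inner ℂ (η n) ((x : H →L[ℂ] H) (ξ n))) (τ x)

/-- `*`-automorphisms of a von Neumann algebra are isometric. -/
theorem norm_aut_apply (B : VonNeumannAlgebra H)
    (φ : B.toStarSubalgebra ≃⋆ₐ[ℂ] B.toStarSubalgebra) (b : B.toStarSubalgebra) :
    ‖((φ b : B.toStarSubalgebra) : H →L[ℂ] H)‖ = ‖(b : H →L[ℂ] H)‖ := by
  have hc : IsClosed (B.toStarSubalgebra : Set (H →L[ℂ] H)) := by
    rw [VonNeumannAlgebra.coe_toStarSubalgebra, ← B.centralizer_centralizer]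
    exact Set.isClosed_centralizer _
  have : IsClosed (B.toStarSubalgebra : Set (H →L[ℂ] H)) := hc
  exact NonUnitalStarAlgHom.norm_map φ (EquivLike.injective φ) b

end VN

/-! ### The crossed product -/

section Crossed

/-- The Hilbert space `ℓ²(Γ, H) = ℓ²(Γ) ⊗ H`. -/
abbrev EllTwo (Γ H : Type*) [NormedAddCommGroup H] : Type _ := lp (fun _ : Γ => H) 2

variable {Γ : Type*} {H : Type*} [NormedAddCommGroup H]

theorem ellTwo_summable_sq (f : EllTwo Γ H) : Summable fun g => ‖f g‖ ^ 2 := by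
  have := (lp.memℓp f).summable (by norm_num)
  simpa using this

theorem ellTwo_mem {f : Γ → H} (hf : Summable fun g => ‖f g‖ ^ 2) : Memℓp f 2 :=
  memℓp_gen (by simpa using hf)

theorem ellTwo_norm_sq (f : EllTwo Γ H) : ‖f‖ ^ 2 = ∑' g, ‖f g‖ ^ 2 := by
  have := lp.norm_rpow_eq_tsum (p := 2) (by norm_num) f
  simpa using this

variable [InnerProductSpace ℂ H]

theorem summable_sq_diag (T : Γ → H →L[ℂ] H) (C : ℝ) (hC : ∀ g, ‖T g‖ ≤ C) (f : EllTwo Γ H) :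
    (∀ g, ‖T g (f g)‖ ^ 2 ≤ C ^ 2 * ‖f g‖ ^ 2) ∧ Summable fun g => ‖T g (f g)‖ ^ 2 := by
  have key : ∀ g, ‖T g (f g)‖ ^ 2 ≤ C ^ 2 * ‖f g‖ ^ 2 := fun g => by
    rw [← mul_pow]
    exact pow_le_pow_left₀ (norm_nonneg _) ((T g).le_of_opNorm_le (hC g) _) 2
  exact ⟨key, Summable.of_nonneg_of_le (fun _ => by positivity) key
    ((ellTwo_summable_sq f).mul_left (C ^ 2))⟩

/-- The diagonal operator `(T ξ)(g) = T_g (ξ(g))` attached to a uniformly bounded family. -/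
def diagOp (T : Γ → H →L[ℂ] H) (C : ℝ) (hC : ∀ g, ‖T g‖ ≤ C) : EllTwo Γ H →L[ℂ] EllTwo Γ H :=
  LinearMap.mkContinuous
    { toFun := fun f => ⟨fun g => T g (f g), ellTwo_mem (summable_sq_diag T C hC f).2⟩
      map_add' := fun f₁ f₂ => lp.ext (funext fun g => map_add (T g) (f₁ g) (f₂ g))
      map_smul' := fun c f => lp.ext (funext fun g => map_smul (T g) c (f g)) }
    |C| (fun f => by
      refine (sq_le_sq₀ (norm_nonneg _) (by positivity)).mp ?_
      rw [mul_pow, sq_abs, ellTwo_norm_sq, ellTwo_norm_sq, ← tsum_mul_left]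
      exact (summable_sq_diag T C hC f).2.tsum_le_tsum (summable_sq_diag T C hC f).1
        ((ellTwo_summable_sq f).mul_left (C ^ 2)))

@[simp]
theorem diagOp_apply (T : Γ → H →L[ℂ] H) (C : ℝ) (hC : ∀ g, ‖T g‖ ≤ C) (f : EllTwo Γ H) (g : Γ) :
    diagOp T C hC f g = T g (f g) := rfl

theorem summable_sq_translation [Group Γ] (h : Γ) (f : EllTwo Γ H) :
    Summable fun g => ‖f (h⁻¹ * g)‖ ^ 2 :=
  (Equiv.mulLeft h⁻¹).summable_iff (f := fun g => ‖f g‖ ^ 2) |>.mpr (ellTwo_summable_sq f)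

/-- The translation operator `(λ(h) ξ)(g) = ξ(h⁻¹ g)` on `ℓ²(Γ, H)`. -/
def translation [Group Γ] (h : Γ) : EllTwo Γ H →L[ℂ] EllTwo Γ H :=
  LinearMap.mkContinuous
    { toFun := fun f => ⟨fun g => f (h⁻¹ * g), ellTwo_mem (summable_sq_translation h f)⟩
      map_add' := fun _ _ => rfl
      map_smul' := fun _ _ => rfl }
    1 (fun f => by
      refine (sq_le_sq₀ (norm_nonneg _) (by positivity)).mp ?_
      rw [one_mul, ellTwo_norm_sq, ellTwo_norm_sq]
      exact ((Equiv.mulLeft h⁻¹).tsum_eq (fun g => ‖f g‖ ^ 2)).le)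

@[simp]
theorem translation_apply [Group Γ] (h : Γ) (f : EllTwo Γ H) (g : Γ) :
    translation h f g = f (h⁻¹ * g) := rfl

variable [CompleteSpace H]

theorem star_diagOp_const (b : H →L[ℂ] H) :
    star (diagOp (fun _ : Γ => b) ‖b‖ (fun _ => le_rfl)) =
      diagOp (fun _ : Γ => star b) ‖star b‖ (fun _ => le_rfl) := by
  symm
  refine (ContinuousLinearMap.eq_adjoint_iff _ _).mpr fun f f' => ?_
  simp [lp.inner_eq_tsum, ContinuousLinearMap.star_eq_adjoint,
    ContinuousLinearMap.adjoint_inner_left]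

variable [Group Γ]

/-- The representation `(π(b) ξ)(g) = α_{g⁻¹}(b) ξ(g)` of `B` on `ℓ²(Γ, H)`. -/
def crossedRep (B : VonNeumannAlgebra H)
    (α : Γ →* (B.toStarSubalgebra ≃⋆ₐ[ℂ] B.toStarSubalgebra)) (b : B.toStarSubalgebra) :
    EllTwo Γ H →L[ℂ] EllTwo Γ H :=
  diagOp (fun g => ((α g⁻¹ b : B.toStarSubalgebra) : H →L[ℂ] H)) ‖(b : H →L[ℂ] H)‖
    (fun _ => (norm_aut_apply B _ b).le)

/-- The crossed product `B ⋊_α Γ`: the von Neumann algebra on `ℓ²(Γ, H)` generated by `π(B)`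
and `λ(Γ)`. -/
def crossedProduct (B : VonNeumannAlgebra H)
    (α : Γ →* (B.toStarSubalgebra ≃⋆ₐ[ℂ] B.toStarSubalgebra)) : VonNeumannAlgebra (EllTwo Γ H) :=
  vonNeumannGenerated (Set.range (crossedRep B α) ∪ Set.range translation)

/-- The subalgebra `L(Γ)` of the crossed product: the von Neumann algebra generated by `λ(Γ)`,
seen as a subalgebra of `B ⋊_α Γ`. -/
def crossedGroupAlgebra (B : VonNeumannAlgebra H)
    (α : Γ →* (B.toStarSubalgebra ≃⋆ₐ[ℂ] B.toStarSubalgebra)) :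
    StarSubalgebra ℂ (crossedProduct B α).toStarSubalgebra :=
  (vonNeumannGenerated
    (Set.range (translation : Γ → EllTwo Γ H →L[ℂ] EllTwo Γ H))).toStarSubalgebra.comap
      (crossedProduct B α).toStarSubalgebra.subtype

open Classical in
/-- The corner `V* x V` of an operator `x` on `ℓ²(Γ, H)`, where `V : H → ℓ²(Γ, H)`
maps `ξ` to the function equal to `ξ` at `1` and to `0` elsewhere. -/
def unitCorner : (EllTwo Γ H →L[ℂ] EllTwo Γ H) →ₗ[ℂ] (H →L[ℂ] H) where
  toFun x := ContinuousLinearMap.adjoint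
      (lp.singleContinuousLinearMap ℂ (fun _ : Γ => H) 2 (1 : Γ)) ∘L x ∘L
      lp.singleContinuousLinearMap ℂ (fun _ : Γ => H) 2 (1 : Γ)
  map_add' x y := by ext; simp
  map_smul' c x := by ext; simp

open Classical in
theorem unitCorner_apply (x : EllTwo Γ H →L[ℂ] EllTwo Γ H) (ξ : H) :
    unitCorner x ξ = x (lp.single 2 (1 : Γ) ξ) 1 := by
  refine ext_inner_left ℂ fun v => ?_
  simp [unitCorner, ContinuousLinearMap.adjoint_inner_right, lp.inner_single_left]

theorem unitCorner_mem (B : VonNeumannAlgebra H)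
    (α : Γ →* (B.toStarSubalgebra ≃⋆ₐ[ℂ] B.toStarSubalgebra))
    {x : EllTwo Γ H →L[ℂ] EllTwo Γ H} (hx : x ∈ (crossedProduct B α).toStarSubalgebra) :
    unitCorner x ∈ B.toStarSubalgebra := by
  classical
  -- `1 ⊗ b'` commutes with the generators for every `b'` in the commutant of `B`
  have hcomm : ∀ b' ∈ B.commutant, ∀ s ∈ Set.range (crossedRep B α) ∪ Set.range translation,
      s * diagOp (fun _ : Γ => b') ‖b'‖ (fun _ => le_rfl) =
        diagOp (fun _ : Γ => b') ‖b'‖ (fun _ => le_rfl) * s := by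
    rintro b' hb' s (⟨b, rfl⟩ | ⟨h, rfl⟩)
    · ext f g
      have := VonNeumannAlgebra.mem_commutant_iff.mp hb' _ (α g⁻¹ b).2
      exact congrArg (fun T : H →L[ℂ] H => T (f g)) this
    · ext f g
      rfl
  have hmem : ∀ b' ∈ B.commutant, diagOp (fun _ : Γ => b') ‖b'‖ (fun _ => le_rfl) ∈
      ((Set.range (crossedRep B α) ∪ Set.range translation) ∪
        star (Set.range (crossedRep B α) ∪ Set.range translation)).centralizer := by
    intro b' hb' s hs
    rcases hs with hs | hs
    · exact hcomm b' hb' s hs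
    · have h := congrArg star (hcomm (star b') (star_mem hb') (star s) hs)
      rw [star_mul, star_mul, star_star, star_diagOp_const] at h
      simp only [star_star] at h
      exact h.symm
  have hx' : x ∈ ((Set.range (crossedRep B α) ∪ Set.range translation) ∪
        star (Set.range (crossedRep B α) ∪ Set.range translation)).centralizer.centralizer := by
    rw [← coe_vonNeumannGenerated]; exact hx
  have hB : unitCorner x ∈ B.commutant.commutant := by
    rw [VonNeumannAlgebra.mem_commutant_iff]
    intro b' hb'
    have hc := hx' _ (hmem b' hb')
    ext ξ
    have hs : diagOp (fun _ : Γ => b') ‖b'‖ (fun _ => le_rfl) (lp.single 2 (1 : Γ) ξ) =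
        lp.single 2 (1 : Γ) (b' ξ) := by
      ext g
      by_cases hg : g = 1
      · subst hg; simp
      · simp [Pi.single_eq_of_ne hg]
    have h1 := congrArg (fun T : EllTwo Γ H →L[ℂ] EllTwo Γ H => T (lp.single 2 (1 : Γ) ξ) 1) hc
    simp only [mul_apply_eq_comp, diagOp_apply, hs] at h1
    simpa [unitCorner_apply] using h1
  rwa [VonNeumannAlgebra.commutant_commutant] at hB

/-- The trace on the crossed product extending the trace `τ` of `B`: `x ↦ τ(V* x V)`, so that
`∑ π(b_g) λ(g) ↦ τ(b_1)`. -/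
def crossedTrace (B : VonNeumannAlgebra H)
    (α : Γ →* (B.toStarSubalgebra ≃⋆ₐ[ℂ] B.toStarSubalgebra))
    (τ : B.toStarSubalgebra →ₗ[ℂ] ℂ) : (crossedProduct B α).toStarSubalgebra →ₗ[ℂ] ℂ where
  toFun x := τ ⟨unitCorner (x : EllTwo Γ H →L[ℂ] EllTwo Γ H), unitCorner_mem B α x.2⟩
  map_add' x y := by
    rw [← map_add]
    exact congrArg τ (Subtype.ext (map_add unitCorner _ _))
  map_smul' c x := by
    rw [RingHom.id_apply, ← map_smul]
    exact congrArg τ (Subtype.ext (map_smul unitCorner c _))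

end Crossed

end

/-!
The trace on `M = B ⋊ Γ` is tracial, `x = ∑ λ(g) π(b_g)` satisfies `‖x‖₂² = ∑ ‖b_g‖₂²`, and the
coefficients of `v ∈ L(Γ)` are scalars `v_g`. The conditional expectation onto `L(Γ)` is the slice
map `id ⊗ τ` on `ℓ²(Γ) ⊗ H`, so that `E(λ(g) π(b)) = τ(b) λ(g)`.

If `L(Γ)` is weakly mixing and `v ∈ L(Γ)` is unitary, then the coefficients of
`E(π(b) v π(a) v*) v` are `v_g τ(α_g(a) b)`, hence
`‖E(π(b) v π(a) v*)‖₂² = ∑ |v_g|² |τ(α_g(a) b)|²`. The weights `|v_g|²` have sum `1`, so when this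
is small for finitely many pairs `(a, b)`, some single `g` makes all `|τ(α_g(a) b)|` small.

Conversely, along elements `p` witnessing that `α` is weakly mixing, `v = λ(p)` satisfies
`‖E(x* v y v*)‖₂ → 0` for monomials `x = λ(g) π(b)`, `y = λ(k) π(c)` with `τ(c) = 0`. The finite
sums of such monomials are `‖·‖₂`-dense in the kernel of `E`.
-/

noncomputable section

open Filter Topology

section EllTwoOperators

namespace EllTwo

variable {ι : Type*} {K : Type*} [NormedAddCommGroup K]

theorem hasSum_norm_sq (f : EllTwo ι K) : HasSum (fun i => ‖f i‖ ^ 2) (‖f‖ ^ 2) := by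
  rw [ellTwo_norm_sq]
  exact (ellTwo_summable_sq f).hasSum

variable [InnerProductSpace ℂ K]

open Classical in
/-- The isometry `K → ℓ²(ι, K)` onto the functions supported at `i`. -/
def single (i : ι) : K →L[ℂ] EllTwo ι K :=
  lp.singleContinuousLinearMap ℂ (fun _ : ι => K) 2 i

open Classical in
theorem single_apply (i : ι) (v : K) (j : ι) : single i v j = if j = i then v else 0 := by
  simp [single, Pi.single_apply]

@[simp]
theorem single_apply_self (i : ι) (v : K) : single i v i = v := by
  simp [single_apply]

theorem norm_single (i : ι) (v : K) : ‖single i v‖ = ‖v‖ := by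
  classical
  simp [single]

theorem inner_single_left (i : ι) (v : K) (f : EllTwo ι K) :
    inner ℂ (single i v) f = inner ℂ v (f i) := by
  classical
  simpa [single] using lp.inner_single_left i v f

theorem adjoint_single_apply [CompleteSpace K] (i : ι) (f : EllTwo ι K) :
    (single (K := K) i).adjoint f = f i := by
  refine ext_inner_left ℂ fun u => ?_
  rw [ContinuousLinearMap.adjoint_inner_right, inner_single_left]

theorem continuousLinearMap_ext {F : Type*} [NormedAddCommGroup F] [NormedSpace ℂ F]
    {S T : EllTwo ι K →L[ℂ] F} (h : ∀ i v, S (single i v) = T (single i v)) : S = T := by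
  classical
  ext f
  have hf := lp.hasSum_single (p := 2) (by norm_num) f
  refine (hf.mapL S).unique ((hf.mapL T).congr_fun fun i => ?_)
  simpa [single] using h i (f i)

/-- The vector of `ℓ²(ι, ℓ²(Γ, K))` with components `single g (ξ i)`. -/
def mapSingle {Γ : Type*} (g : Γ) (ξ : EllTwo ι K) : EllTwo ι (EllTwo Γ K) :=
  ⟨fun i => single g (ξ i), ellTwo_mem (by simpa only [norm_single] using ellTwo_summable_sq ξ)⟩

theorem mapSingle_apply {Γ : Type*} (g : Γ) (ξ : EllTwo ι K) (i : ι) :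
    mapSingle g ξ i = single g (ξ i) := rfl

theorem hasSum_inner_prod {Γ : Type*} (f f' : EllTwo ι (EllTwo Γ K)) :
    HasSum (fun p : ι × Γ => inner ℂ (f p.1 p.2) (f' p.1 p.2)) (inner ℂ f f') := by
  have hsum (f : EllTwo ι (EllTwo Γ K)) : Summable fun p : ι × Γ => ‖f p.1 p.2‖ ^ 2 :=
    (summable_prod_of_nonneg fun p => sq_nonneg _).mpr ⟨fun i => ellTwo_summable_sq (f i), by
      simpa only [← ellTwo_norm_sq] using ellTwo_summable_sq f⟩
  have hprod := lp.hasSum_inner (𝕜 := ℂ) (⟨_, ellTwo_mem (hsum f)⟩ : EllTwo (ι × Γ) K)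
    ⟨_, ellTwo_mem (hsum f')⟩
  have hiter := hprod.prod_fiberwise fun i => lp.hasSum_inner (𝕜 := ℂ) (f i) (f' i)
  rwa [hiter.unique (lp.hasSum_inner (𝕜 := ℂ) f f')] at hprod

end EllTwo

variable {K : Type*} [NormedAddCommGroup K] [InnerProductSpace ℂ K] {ι : Type*}

/-- The amplification `1 ⊗ x` of an operator `x` on `K` to `ℓ²(ι, K) = ℓ²(ι) ⊗ K`. -/
def amplify (ι : Type*) (x : K →L[ℂ] K) : EllTwo ι K →L[ℂ] EllTwo ι K :=
  diagOp (fun _ => x) ‖x‖ fun _ => le_rfl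

@[simp]
theorem amplify_apply (x : K →L[ℂ] K) (f : EllTwo ι K) (i : ι) : amplify ι x f i = x (f i) := rfl

theorem amplify_single (x : K →L[ℂ] K) (i : ι) (v : K) :
    amplify ι x (EllTwo.single i v) = EllTwo.single i (x v) := by
  ext j
  simp only [amplify_apply, EllTwo.single_apply]
  split_ifs <;> simp

theorem hasSum_inner_amplify (η ξ : EllTwo ι K) (x : K →L[ℂ] K) :
    HasSum (fun i => inner ℂ (η i) (x (ξ i))) (inner ℂ η (amplify ι x ξ)) :=
  lp.hasSum_inner η (amplify ι x ξ)

variable [CompleteSpace K]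

theorem star_amplify (x : K →L[ℂ] K) : star (amplify ι x) = amplify ι (star x) :=
  star_diagOp_const x

theorem inner_amplify_left (x : K →L[ℂ] K) (f f' : EllTwo ι K) :
    inner ℂ (amplify ι x f) f' = inner ℂ f (amplify ι (star x) f') := by
  rw [← star_amplify, ContinuousLinearMap.star_eq_adjoint,
    ContinuousLinearMap.adjoint_inner_right]

end EllTwoOperators

section DoubleCommutant

variable {K : Type*} [NormedAddCommGroup K] [InnerProductSpace ℂ K] [CompleteSpace K]
  {ι : Type*}

theorem commute_starProjection {V : Submodule ℂ K} [V.HasOrthogonalProjection] {T : K →L[ℂ] K}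
    (hT : ∀ f ∈ V, T f ∈ V) (hT' : ∀ f ∈ V, star T f ∈ V) : Commute V.starProjection T := by
  refine ContinuousLinearMap.ext fun f => Submodule.eq_starProjection_of_mem_of_inner_eq_zero
    (hT _ (V.starProjection_apply_mem f)) fun w hw => ?_
  change inner ℂ (T f - T (V.starProjection f)) w = 0
  rw [← map_sub, ← ContinuousLinearMap.adjoint_inner_right]
  exact V.starProjection_inner_eq_zero f _ (hT' w hw)

/-- The matrix entries of `P` with respect to `ℓ²(ι, K) = ⨁ K` lie in the commutant of `S`. -/
theorem commute_amplify_of_mem_centralizer_centralizer {S : Set (K →L[ℂ] K)}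
    {P : EllTwo ι K →L[ℂ] EllTwo ι K} (hP : ∀ s ∈ S, Commute P (amplify ι s)) {z : K →L[ℂ] K}
    (hz : z ∈ S.centralizer.centralizer) : Commute P (amplify ι z) := by
  have hentry (i j : ι) : (EllTwo.single i).adjoint ∘L P ∘L EllTwo.single j ∈ S.centralizer := by
    intro s hs
    ext v
    have := congr($(hP s hs) (EllTwo.single j v) i)
    simpa [EllTwo.adjoint_single_apply, amplify_single] using this.symm
  refine EllTwo.continuousLinearMap_ext fun j v => lp.ext (funext fun i => ?_)
  have := congr($(hz _ (hentry i j)) v)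
  simpa [EllTwo.adjoint_single_apply, amplify_single] using this

theorem amplify_mem_topologicalClosure_span {S : Submonoid (K →L[ℂ] K)}
    (hS : ∀ s ∈ S, star s ∈ S) (ξ : EllTwo ι K) {z : K →L[ℂ] K}
    (hz : z ∈ Set.centralizer (Set.centralizer (S : Set (K →L[ℂ] K)))) :
    amplify ι z ξ ∈ (Submodule.span ℂ ((fun s => amplify ι s ξ) '' S)).topologicalClosure := by
  set V := (Submodule.span ℂ ((fun s => amplify ι s ξ) '' S)).topologicalClosure
  have hV_closed : IsClosed (V : Set (EllTwo ι K)) := Submodule.isClosed_topologicalClosure _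
  have : CompleteSpace V := hV_closed.completeSpace_coe
  have hmem : ∀ s ∈ S, amplify ι s ξ ∈ V := fun s hs =>
    Submodule.le_topologicalClosure _ (Submodule.subset_span ⟨s, hs, rfl⟩)
  have hinv : ∀ s ∈ S, V ≤ V.comap (amplify ι s).toLinearMap := by
    refine fun s hs => Submodule.topologicalClosure_minimal _ (Submodule.span_le.mpr ?_)
      (hV_closed.preimage (amplify ι s).continuous)
    rintro _ ⟨t, ht, rfl⟩
    exact hmem (s * t) (mul_mem hs ht)
  have hcomm : Commute V.starProjection (amplify ι z) :=
    commute_amplify_of_mem_centralizer_centralizer (fun s hs => commute_starProjection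
      (hinv s hs) (by rw [star_amplify]; exact hinv _ (hS s hs))) hz
  have hξ : V.starProjection ξ = ξ := V.starProjection_eq_self_iff.mpr (hmem 1 (one_mem S))
  rw [← V.starProjection_eq_self_iff]
  exact congr($(hcomm) ξ).trans (congrArg (amplify ι z) hξ)

end DoubleCommutant

section NormalFunctional

universe v w

variable {K : Type*} [NormedAddCommGroup K] [InnerProductSpace ℂ K] [CompleteSpace K]
  {N : StarSubalgebra ℂ (K →L[ℂ] K)}

/-- A functional `φ` on an algebra `N` of operators on `K` is *normal* if it has the form
`φ(x) = ∑ᵢ ⟨x ξᵢ, ηᵢ⟩` with `∑ ‖ξᵢ‖² < ∞` and `∑ ‖ηᵢ‖² < ∞`. The families are vectors of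
`ℓ²(ι, K)`; any index type is allowed, since only countably many terms are nonzero. -/
def IsNormalFunctional (φ : N → ℂ) : Prop :=
  ∃ (ι : Type v) (η ξ : EllTwo ι K), ∀ x : N, φ x = inner ℂ η (amplify ι x ξ)

theorem isNormalFunctional_inner (u w : K) :
    IsNormalFunctional.{0} fun x : N => inner ℂ u ((x : K →L[ℂ] K) w) :=
  ⟨Unit, EllTwo.single () u, EllTwo.single () w, fun x => by
    rw [amplify_single, EllTwo.inner_single_left, EllTwo.single_apply_self]⟩

namespace IsNormalFunctional

variable {φ : N → ℂ} {ψ : N → ℂ}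

theorem mul_left (hφ : IsNormalFunctional.{v} φ) (y : N) :
    IsNormalFunctional.{v} fun x => φ (y * x) := by
  obtain ⟨ι, η, ξ, h⟩ := hφ
  refine ⟨ι, amplify ι (star (y : K →L[ℂ] K)) η, ξ, fun x => (h (y * x)).trans ?_⟩
  rw [inner_amplify_left, star_star]
  rfl

theorem mul_right (hφ : IsNormalFunctional.{v} φ) (y : N) :
    IsNormalFunctional.{v} fun x => φ (x * y) := by
  obtain ⟨ι, η, ξ, h⟩ := hφ
  exact ⟨ι, η, amplify ι (y : K →L[ℂ] K) ξ, fun x => h (x * y)⟩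

theorem const_mul (hφ : IsNormalFunctional.{v} φ) (c : ℂ) :
    IsNormalFunctional.{v} fun x => c * φ x := by
  obtain ⟨ι, η, ξ, h⟩ := hφ
  exact ⟨ι, η, c • ξ, fun x => by simp only [h, map_smul, inner_smul_right]⟩

theorem sub (hφ : IsNormalFunctional.{v} φ) (hψ : IsNormalFunctional.{w} ψ) :
    IsNormalFunctional.{max v w} fun x => φ x - ψ x := by
  obtain ⟨ι, η, ξ, hφ⟩ := hφ
  obtain ⟨κ, η', ξ', hψ⟩ := hψ
  have hsum (f : EllTwo ι K) (f' : EllTwo κ K) :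
      Summable fun i => ‖(Sum.elim f f' : ι ⊕ κ → K) i‖ ^ 2 :=
    Summable.sum _ (ellTwo_summable_sq f) (ellTwo_summable_sq f')
  set η₂ : EllTwo (ι ⊕ κ) K := ⟨_, ellTwo_mem (hsum η (-η'))⟩
  set ξ₂ : EllTwo (ι ⊕ κ) K := ⟨_, ellTwo_mem (hsum ξ ξ')⟩
  have h (x : N) :
      HasSum (fun i => inner ℂ (η₂ i) ((x : K →L[ℂ] K) (ξ₂ i))) (φ x - ψ x) := by
    rw [hφ, hψ, sub_eq_add_neg, ← inner_neg_left]
    exact HasSum.sum (hasSum_inner_amplify η ξ _) (hasSum_inner_amplify (-η') ξ' _)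
  exact ⟨ι ⊕ κ, η₂, ξ₂, fun x => (h x).unique (hasSum_inner_amplify η₂ ξ₂ _)⟩

variable {S : Submonoid N} {z : N}

theorem eq_zero_of_mem_centralizer_centralizer (hφ : IsNormalFunctional.{v} φ)
    (hS : ∀ s ∈ S, star s ∈ S) (h : ∀ s ∈ S, φ s = 0)
    (hz : (z : K →L[ℂ] K) ∈ Set.centralizer (Set.centralizer (Subtype.val '' (S : Set N)))) :
    φ z = 0 := by
  obtain ⟨ι, η, ξ, hφ⟩ := hφ
  have hz_mem := amplify_mem_topologicalClosure_span (S := S.map N.subtype)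
    (by rintro _ ⟨s, hs, rfl⟩; exact ⟨star s, hS s hs, rfl⟩) ξ hz
  have hle : (Submodule.span ℂ ((fun s => amplify ι s ξ) '' S.map N.subtype)).topologicalClosure ≤
      (innerSL ℂ η).toLinearMap.ker := by
    refine Submodule.topologicalClosure_minimal _ (Submodule.span_le.mpr ?_)
      (ContinuousLinearMap.isClosed_ker (innerSL ℂ η))
    rintro _ ⟨_, ⟨s, hs, rfl⟩, rfl⟩
    exact (hφ s).symm.trans (h s hs)
  exact (hφ z).trans (hle hz_mem)

theorem eq_of_mem_centralizer_centralizer (hφ : IsNormalFunctional.{v} φ)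
    (hψ : IsNormalFunctional.{w} ψ) (hS : ∀ s ∈ S, star s ∈ S) (h : ∀ s ∈ S, φ s = ψ s)
    (hz : (z : K →L[ℂ] K) ∈ Set.centralizer (Set.centralizer (Subtype.val '' (S : Set N)))) :
    φ z = ψ z :=
  sub_eq_zero.mp <| (hφ.sub hψ).eq_zero_of_mem_centralizer_centralizer hS
    (fun s hs => sub_eq_zero.mpr (h s hs)) hz

end IsNormalFunctional

end NormalFunctional

section Generated

variable {K : Type*} [NormedAddCommGroup K] [InnerProductSpace ℂ K] [CompleteSpace K]

theorem subset_vonNeumannGenerated (s : Set (K →L[ℂ] K)) :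
    s ⊆ ((vonNeumannGenerated s).toStarSubalgebra : Set (K →L[ℂ] K)) := by
  rw [coe_vonNeumannGenerated]
  exact Set.subset_union_left.trans Set.subset_centralizer_centralizer

theorem vonNeumannGenerated_mono {s t : Set (K →L[ℂ] K)} (h : s ⊆ t) :
    (vonNeumannGenerated s).toStarSubalgebra ≤ (vonNeumannGenerated t).toStarSubalgebra := by
  rw [← SetLike.coe_subset_coe, coe_vonNeumannGenerated, coe_vonNeumannGenerated]
  exact Set.centralizer_subset (Set.centralizer_subset
    (Set.union_subset_union h (Set.star_subset_star.mpr h)))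

theorem vonNeumannGenerated_subset_centralizer_centralizer {s S : Set (K →L[ℂ] K)} (hs : s ⊆ S)
    (hS : ∀ x ∈ S, star x ∈ S) :
    ((vonNeumannGenerated s).toStarSubalgebra : Set (K →L[ℂ] K)) ⊆
      S.centralizer.centralizer := by
  rw [coe_vonNeumannGenerated]
  refine Set.centralizer_subset (Set.centralizer_subset (Set.union_subset hs fun x hx => ?_))
  simpa using hS _ (hs hx)

theorem isClosed_vonNeumannAlgebra (N : VonNeumannAlgebra K) :
    IsClosed (N.toStarSubalgebra : Set (K →L[ℂ] K)) := by
  rw [VonNeumannAlgebra.coe_toStarSubalgebra, ← N.centralizer_centralizer]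
  exact Set.isClosed_centralizer _

end Generated

section TwoNorm

variable {M : Type*} [Ring M] [StarRing M] [Algebra ℂ M] {T : M →ₗ[ℂ] ℂ}

theorem twoNorm_nonneg (x : M) : 0 ≤ twoNorm T x := Real.sqrt_nonneg _

theorem twoNorm_zero : twoNorm T (0 : M) = 0 := by simp [twoNorm]

theorem twoNorm_sq (hT : ∀ x, 0 ≤ T (star x * x)) (x : M) :
    twoNorm T x ^ 2 = (T (star x * x)).re :=
  Real.sq_sqrt (Complex.nonneg_iff.mp (hT x)).1

theorem twoNorm_smul [StarModule ℂ M] (c : ℂ) (x : M) :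
    twoNorm T (c • x) = ‖c‖ * twoNorm T x := by
  have h : T (star (c • x) * (c • x)) = ((‖c‖ ^ 2 : ℝ) : ℂ) * T (star x * x) := by
    rw [star_smul, smul_mul_smul_comm, map_smul, smul_eq_mul, Complex.star_def,
      Complex.conj_mul', Complex.ofReal_pow]
  rw [twoNorm, h, Complex.re_ofReal_mul, Real.sqrt_mul (by positivity),
    Real.sqrt_sq (norm_nonneg c), twoNorm]

theorem twoNorm_unitary_mul {v : M} (hv : v ∈ unitary M) (x : M) :
    twoNorm T (v * x) = twoNorm T x := by
  rw [twoNorm, star_mul, mul_assoc, ← mul_assoc (star v), Unitary.star_mul_self_of_mem hv,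
    one_mul, twoNorm]

theorem twoNorm_star (hT : ∀ x y, T (x * y) = T (y * x)) (x : M) :
    twoNorm T (star x) = twoNorm T x := by
  rw [twoNorm, star_star, hT, twoNorm]

theorem twoNorm_mul_unitary (hT : ∀ x y, T (x * y) = T (y * x)) {v : M} (hv : v ∈ unitary M)
    (x : M) : twoNorm T (x * v) = twoNorm T x := by
  rw [← twoNorm_star hT, star_mul, twoNorm_unitary_mul (Unitary.star_mem hv), twoNorm_star hT]

theorem twoNorm_starAlgEquiv {σ : M ≃⋆ₐ[ℂ] M} (hσ : ∀ x, T (σ x) = T x) (x : M) :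
    twoNorm T (σ x) = twoNorm T x := by
  rw [twoNorm, ← map_star, ← map_mul, hσ, twoNorm]

theorem apply_star_of_nonneg [StarModule ℂ M] (hT : ∀ x, 0 ≤ T (star x * x)) (x : M) :
    T (star x) = star (T x) := by
  have him (y : M) : (T (star y * y)).im = 0 := (Complex.nonneg_iff.mp (hT y)).2.symm
  have hpolar (c : ℂ) : (c * T x + star c * T (star x)).im = 0 := by
    have hexpand : star (1 + c • x) * (1 + c • x) =
        star 1 * 1 + (c • x + star c • star x) + star (c • x) * (c • x) := by
      rw [star_add, star_one, star_smul, add_mul, mul_add, mul_add, one_mul, one_mul, mul_one]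
      abel
    have h := him (1 + c • x)
    rwa [hexpand, map_add, map_add, Complex.add_im, Complex.add_im, him, him, add_zero, zero_add,
      map_add, map_smul, map_smul] at h
  have hone := hpolar 1
  have hI := hpolar Complex.I
  simp only [star_one, one_mul, Complex.add_im] at hone
  simp only [Complex.star_def, Complex.conj_I, neg_mul, Complex.add_im, Complex.neg_im,
    Complex.I_mul_im] at hI
  refine Complex.ext ?_ ?_ <;>
    simp only [Complex.star_def, Complex.conj_re, Complex.conj_im] <;> linarith

theorem twoNorm_add_le [StarModule ℂ M] (hT : ∀ x, 0 ≤ T (star x * x)) (x y : M) :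
    twoNorm T (x + y) ≤ twoNorm T x + twoNorm T y := by
  let core : PreInnerProductSpace.Core ℂ M :=
    { inner x y := T (star x * y)
      conj_inner_symm x y := by
        rw [← Complex.star_def, ← apply_star_of_nonneg hT, star_mul, star_star]
      re_inner_nonneg x := (Complex.nonneg_iff.mp (hT x)).1
      add_left x y z := by rw [star_add, add_mul, map_add]
      smul_left x y c := by rw [star_smul, smul_mul_assoc, map_smul]; rfl }
  let := InnerProductSpace.Core.toSeminormedAddCommGroup (𝕜 := ℂ) (F := M)
  exact norm_add_le x y

end TwoNorm

section CStarTwoNorm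

variable {M : Type*} [CStarAlgebra M] {T : M →ₗ[ℂ] ℂ}

theorem twoNorm_mul_le_norm_mul (hT : ∀ x, 0 ≤ T (star x * x)) (x y : M) :
    twoNorm T (x * y) ≤ ‖x‖ * twoNorm T y := by
  let := CStarAlgebra.spectralOrder M
  have := CStarAlgebra.spectralOrderedRing M
  obtain ⟨d, hd⟩ := CStarAlgebra.nonneg_iff_eq_star_mul_self.mp
    (sub_nonneg.mpr (CStarAlgebra.star_mul_le_algebraMap_norm_sq (a := x)))
  have hdy : star (d * y) * (d * y) =
      ((‖x‖ ^ 2 : ℝ) : ℂ) • (star y * y) - star (x * y) * (x * y) := by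
    rw [star_mul, mul_assoc, ← mul_assoc (star d), ← hd, sub_mul, mul_sub, star_mul,
      Algebra.algebraMap_eq_smul_one, smul_mul_assoc, one_mul, mul_smul_comm, mul_assoc (star y),
      mul_assoc (star x), Complex.coe_smul]
  have hle := (Complex.nonneg_iff.mp (hT (d * y))).1
  rw [hdy, map_sub, map_smul, smul_eq_mul, Complex.sub_re, Complex.re_ofReal_mul,
    ← twoNorm_sq hT, ← twoNorm_sq hT, sub_nonneg, ← mul_pow] at hle
  exact le_of_sq_le_sq hle (mul_nonneg (norm_nonneg x) (twoNorm_nonneg y))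

theorem twoNorm_mul_le_mul_norm (hT : ∀ x, 0 ≤ T (star x * x))
    (hT' : ∀ x y, T (x * y) = T (y * x)) (x y : M) :
    twoNorm T (x * y) ≤ twoNorm T x * ‖y‖ := by
  rw [← twoNorm_star hT', star_mul, mul_comm, ← norm_star y, ← twoNorm_star hT' x]
  exact twoNorm_mul_le_norm_mul hT _ _

end CStarTwoNorm

namespace IsConditionalExpectation

variable {M : Type*} [Ring M] [StarRing M] [Algebra ℂ M] [StarModule ℂ M] {T : M →ₗ[ℂ] ℂ}
  {A : StarSubalgebra ℂ M} {E : M → M}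

theorem eq_of_forall_apply_mul_eq (hE : IsConditionalExpectation T A E)
    (hA : ∀ a ∈ A, T (star a * a) = 0 → a = 0) {x a : M} (ha : a ∈ A)
    (hx : ∀ b ∈ A, T (a * b) = T (x * b)) : E x = a := by
  have hd : E x - a ∈ A := sub_mem (hE x).1 ha
  have hd' : star (E x - a) ∈ A := star_mem hd
  have : star (E x - a) = 0 := hA _ hd' (by
    rw [star_star, sub_mul, map_sub, (hE x).2 _ hd', hx _ hd', sub_self])
  exact sub_eq_zero.mp (star_eq_zero.mp this)

theorem map_add (hE : IsConditionalExpectation T A E)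
    (hA : ∀ a ∈ A, T (star a * a) = 0 → a = 0) (x y : M) : E (x + y) = E x + E y :=
  hE.eq_of_forall_apply_mul_eq hA (add_mem (hE x).1 (hE y).1) fun b hb => by
    rw [add_mul, add_mul, _root_.map_add, _root_.map_add, (hE x).2 b hb, (hE y).2 b hb]

theorem twoNorm_le (hE : IsConditionalExpectation T A E)
    (hT : ∀ x, 0 ≤ T (star x * x)) (hT' : ∀ x y, T (x * y) = T (y * x)) (x : M) :
    twoNorm T (E x) ≤ twoNorm T x := by
  have hleft : T (star (E x) * x) = T (star (E x) * E x) := by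
    rw [hT', hT' (star _), (hE x).2 _ (star_mem (hE x).1)]
  have hright : T (star x * E x) = star (T (star (E x) * E x)) := by
    rw [← hleft, ← apply_star_of_nonneg hT, star_mul, star_star]
  have hpythagoras :
      twoNorm T (x - E x) ^ 2 = twoNorm T x ^ 2 - twoNorm T (E x) ^ 2 := by
    simp only [twoNorm_sq hT, star_sub, sub_mul, mul_sub, map_sub, Complex.sub_re, hleft, hright,
      Complex.star_def, Complex.conj_re]
    ring
  refine le_of_sq_le_sq ?_ (twoNorm_nonneg x)
  linarith [sq_nonneg (twoNorm T (x - E x))]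

end IsConditionalExpectation

section TracialState

variable {M : Type*} [Ring M] [StarRing M] [Algebra ℂ M]

/-- A tracial state on a `*`-algebra: a trace in the sense of `IsNormalFaithfulTrace`, without the
requirements of faithfulness and normality. -/
structure IsTracialState (T : M →ₗ[ℂ] ℂ) : Prop where
  map_one : T 1 = 1
  nonneg : ∀ x, 0 ≤ T (star x * x)
  tracial : ∀ x y, T (x * y) = T (y * x)

theorem IsTracialState.twoNorm_unitary {T : M →ₗ[ℂ] ℂ} (hT : IsTracialState T) {v : M}
    (hv : v ∈ unitary M) : twoNorm T v = 1 := by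
  rw [twoNorm, Unitary.star_mul_self_of_mem hv, hT.map_one, Complex.one_re, Real.sqrt_one]

/-- The closure of `D` with respect to the seminorm `‖·‖₂`. -/
def twoNormClosure (T : M →ₗ[ℂ] ℂ) (D : Set M) : Set M :=
  {x | ∀ ε > 0, ∃ y ∈ D, twoNorm T (x - y) < ε}

end TracialState

section Averaging

theorem exists_forall_lt_of_hasSum {ι κ : Type*} {w : ι → ℝ} (hw : ∀ i, 0 ≤ w i)
    (hw_sum : HasSum w 1) {s : Finset κ} {f : κ → ι → ℝ} (hf : ∀ k i, 0 ≤ f k i) {C : κ → ℝ}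
    (hC : ∀ k ∈ s, HasSum (fun i => w i * f k i) (C k)) {ε : ℝ} (hε : ∑ k ∈ s, C k < ε) :
    ∃ i, ∀ k ∈ s, f k i < ε := by
  by_contra! hcon
  have hle (i : ι) : w i * ε ≤ ∑ k ∈ s, w i * f k i := by
    obtain ⟨k, hk, hki⟩ := hcon i
    exact (mul_le_mul_of_nonneg_left hki (hw i)).trans
      (Finset.single_le_sum (fun k _ => mul_nonneg (hw i) (hf k i)) hk)
  have := hasSum_le hle (hw_sum.mul_right ε) (hasSum_sum hC)
  linarith

theorem tendsto_nhds_zero_of_forall_le_add {ι : Type*} {l : Filter ι} {f : ι → ℝ}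
    (hf : ∀ i, 0 ≤ f i)
    (h : ∀ ε > 0, ∃ g : ι → ℝ, Tendsto g l (𝓝 0) ∧ ∀ i, f i ≤ g i + ε) :
    Tendsto f l (𝓝 0) := by
  refine tendsto_order.mpr ⟨fun a ha => .of_forall fun i => ha.trans_le (hf i), fun ε hε => ?_⟩
  obtain ⟨g, hg, hfg⟩ := h (ε / 2) (half_pos hε)
  filter_upwards [hg.eventually_lt_const (half_pos hε)] with i hi
  linarith [hfg i]

end Averaging

section Approximation

variable {M : Type*} [CStarAlgebra M] {T : M →ₗ[ℂ] ℂ} {A : StarSubalgebra ℂ M} {E : M → M}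
  {ι : Type*} {l : Filter ι} {σ : ι → M ≃⋆ₐ[ℂ] M}

namespace IsConditionalExpectation

theorem twoNorm_star_mul_le (hE : IsConditionalExpectation T A E)
    (hA : ∀ a ∈ A, T (star a * a) = 0 → a = 0) (hT : IsTracialState T) {θ : M ≃⋆ₐ[ℂ] M}
    (hθ : ∀ x, T (θ x) = T x) (x x₀ y y₀ : M) :
    twoNorm T (E (star x * θ y)) ≤
      twoNorm T (E (star x₀ * θ y₀)) + (twoNorm T (x - x₀) * ‖y‖ + ‖x₀‖ * twoNorm T (y - y₀)) := by
  have hsplit : star x * θ y =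
      star x₀ * θ y₀ + (star (x - x₀) * θ y + star x₀ * θ (y - y₀)) := by
    rw [star_sub, map_sub]
    noncomm_ring
  have hleft : twoNorm T (star (x - x₀) * θ y) ≤ twoNorm T (x - x₀) * ‖y‖ := by
    rw [← twoNorm_star hT.tracial (x - x₀),
      ← NonUnitalStarAlgHom.norm_map θ (EquivLike.injective θ) y]
    exact twoNorm_mul_le_mul_norm hT.nonneg hT.tracial _ _
  have hright : twoNorm T (star x₀ * θ (y - y₀)) ≤ ‖x₀‖ * twoNorm T (y - y₀) := by
    rw [← norm_star x₀, ← twoNorm_starAlgEquiv hθ (y - y₀)]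
    exact twoNorm_mul_le_norm_mul hT.nonneg _ _
  rw [hsplit, hE.map_add hA]
  refine (twoNorm_add_le hT.nonneg _ _).trans (add_le_add_right ?_ _)
  exact (hE.twoNorm_le hT.nonneg hT.tracial _).trans
    ((twoNorm_add_le hT.nonneg _ _).trans (add_le_add hleft hright))

theorem tendsto_twoNorm_star_mul_of_mem_twoNormClosure (hE : IsConditionalExpectation T A E)
    (hA : ∀ a ∈ A, T (star a * a) = 0 → a = 0) (hT : IsTracialState T)
    (hσ : ∀ i x, T (σ i x) = T x) {D : Set M}
    (hD : ∀ x ∈ D, ∀ y ∈ D, Tendsto (fun i => twoNorm T (E (star x * σ i y))) l (𝓝 0))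
    {x y : M} (hx : x ∈ twoNormClosure T D) (hy : y ∈ twoNormClosure T D) :
    Tendsto (fun i => twoNorm T (E (star x * σ i y))) l (𝓝 0) := by
  refine tendsto_nhds_zero_of_forall_le_add (fun i => twoNorm_nonneg _) fun ε hε => ?_
  obtain ⟨x₀, hx₀, hxx₀⟩ := hx (ε / 2 / (‖y‖ + 1)) (by positivity)
  obtain ⟨y₀, hy₀, hyy₀⟩ := hy (ε / 2 / (‖x₀‖ + 1)) (by positivity)
  refine ⟨_, hD x₀ hx₀ y₀ hy₀, fun i =>
    (hE.twoNorm_star_mul_le hA hT (hσ i) x x₀ y y₀).trans (add_le_add_right ?_ _)⟩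
  rw [lt_div_iff₀ (by positivity)] at hxx₀ hyy₀
  linarith [twoNorm_nonneg (T := T) (x - x₀), twoNorm_nonneg (T := T) (y - y₀)]

theorem tendsto_twoNorm_star_mul_of_mem_closure (hE : IsConditionalExpectation T A E)
    (hA : ∀ a ∈ A, T (star a * a) = 0 → a = 0) (hT : ∀ x, 0 ≤ T (star x * x)) {D : Set M}
    (hD : ∀ x ∈ D, ∀ y ∈ D, Tendsto (fun i => twoNorm T (E (star x * σ i y))) l (𝓝 0))
    {x y : M} (hx : x ∈ AddSubmonoid.closure D) (hy : y ∈ AddSubmonoid.closure D) :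
    Tendsto (fun i => twoNorm T (E (star x * σ i y))) l (𝓝 0) := by
  have hE_zero : twoNorm T (E 0) = 0 := by
    rw [add_eq_left.mp ((hE.map_add hA 0 0).symm.trans (congrArg E (add_zero 0))), twoNorm_zero]
  have hE_add {f f' : ι → M} (hf : Tendsto (fun i => twoNorm T (E (f i))) l (𝓝 0))
      (hf' : Tendsto (fun i => twoNorm T (E (f' i))) l (𝓝 0)) :
      Tendsto (fun i => twoNorm T (E (f i + f' i))) l (𝓝 0) := by
    refine squeeze_zero (fun i => twoNorm_nonneg _) (fun i => ?_) (by simpa using hf.add hf')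
    rw [hE.map_add hA]
    exact twoNorm_add_le hT _ _
  induction hx, hy using AddSubmonoid.closure_induction₂ with
  | mem x y hx hy => exact hD x hx y hy
  | zero_left y => simpa [hE_zero] using tendsto_const_nhds
  | zero_right x => simpa [hE_zero] using tendsto_const_nhds
  | add_left x x' y _ _ _ h h' => simpa only [star_add, add_mul] using hE_add h h'
  | add_right y y' x _ _ _ h h' => simpa only [_root_.map_add, mul_add] using hE_add h h'

end IsConditionalExpectation

end Approximation

theorem IsWeaklyMixingAction.exists_tendsto {N Γ : Type*} [Ring N] [StarRing N] [Algebra ℂ N]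
    [Group Γ] {τ : N →ₗ[ℂ] ℂ} {α : Γ →* (N ≃⋆ₐ[ℂ] N)} (hα : IsWeaklyMixingAction τ α) :
    ∃ p : Finset N × ℕ → Γ, ∀ a b,
      Tendsto (fun i => τ (α (p i) a * b)) atTop (𝓝 (τ a * τ b)) := by
  classical
  choose p hp using fun i : Finset N × ℕ =>
    hα i.1 (1 / ((i.2 : ℝ) + 1)) Nat.one_div_pos_of_nat
  refine ⟨p, fun a b => ?_⟩
  have hlim : Tendsto (fun i : Finset N × ℕ => 1 / ((i.2 : ℝ) + 1)) atTop (𝓝 0) := by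
    rw [← prod_atTop_atTop_eq]
    exact tendsto_one_div_add_atTop_nhds_zero_nat.comp tendsto_snd
  rw [tendsto_iff_norm_sub_tendsto_zero]
  refine squeeze_zero' (.of_forall fun _ => norm_nonneg _) ?_ hlim
  filter_upwards [eventually_ge_atTop (({a, b} : Finset N), 0)] with i hi
  exact (hp i a (hi.1 (by simp)) b (hi.1 (by simp))).le

section Crossed

variable {Γ : Type*} {H : Type*} [NormedAddCommGroup H] [InnerProductSpace ℂ H] [Group Γ]

section Translation

theorem translation_one : translation (1 : Γ) = (1 : EllTwo Γ H →L[ℂ] EllTwo Γ H) := by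
  ext f g
  simp

theorem translation_mul (g h : Γ) :
    (translation (g * h) : EllTwo Γ H →L[ℂ] EllTwo Γ H) = translation g * translation h := by
  ext f k
  simp [mul_assoc]

theorem translation_single (h g : Γ) (v : H) :
    translation h (EllTwo.single g v) = EllTwo.single (h * g) v := by
  ext k
  rw [translation_apply, EllTwo.single_apply, EllTwo.single_apply]
  classical exact if_congr inv_mul_eq_iff_eq_mul rfl rfl

variable [CompleteSpace H]

theorem star_translation (g : Γ) :
    star (translation g : EllTwo Γ H →L[ℂ] EllTwo Γ H) = translation g⁻¹ := by
  symm
  refine (ContinuousLinearMap.eq_adjoint_iff _ _).mpr fun f f' => ?_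
  rw [lp.inner_eq_tsum, lp.inner_eq_tsum, ← (Equiv.mulLeft g⁻¹).tsum_eq]
  simp

theorem unitCorner_apply_single (x : EllTwo Γ H →L[ℂ] EllTwo Γ H) (v : H) :
    unitCorner x v = x (EllTwo.single 1 v) 1 :=
  unitCorner_apply x v

end Translation

section CrossedProduct

theorem starAut_apply_inv_apply {N : Type*} [Ring N] [StarRing N] [Algebra ℂ N]
    (α : Γ →* (N ≃⋆ₐ[ℂ] N)) (g : Γ) (x : N) : α g (α g⁻¹ x) = x := by
  rw [← StarAlgEquiv.mul_apply, ← map_mul, mul_inv_cancel, map_one, StarAlgEquiv.one_apply]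

variable [CompleteSpace H] (B : VonNeumannAlgebra H)
  (α : Γ →* (B.toStarSubalgebra ≃⋆ₐ[ℂ] B.toStarSubalgebra))

@[simp]
theorem crossedRep_apply (b : B.toStarSubalgebra) (f : EllTwo Γ H) (g : Γ) :
    crossedRep B α b f g = (α g⁻¹ b : H →L[ℂ] H) (f g) := rfl

theorem crossedRep_single (b : B.toStarSubalgebra) (g : Γ) (v : H) :
    crossedRep B α b (EllTwo.single g v) = EllTwo.single g ((α g⁻¹ b : H →L[ℂ] H) v) := by
  ext k
  rw [crossedRep_apply, EllTwo.single_apply, EllTwo.single_apply]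
  split_ifs with h
  · rw [h]
  · rw [map_zero]

theorem star_crossedRep (b : B.toStarSubalgebra) :
    star (crossedRep B α b) = crossedRep B α (star b) := by
  symm
  refine (ContinuousLinearMap.eq_adjoint_iff _ _).mpr fun f f' => ?_
  simp only [lp.inner_eq_tsum, crossedRep_apply, map_star, StarMemClass.coe_star,
    ContinuousLinearMap.star_eq_adjoint, ContinuousLinearMap.adjoint_inner_left]

/-- The embedding `π` of `B` into the crossed product. -/
def crossedEmbedding : B.toStarSubalgebra →⋆ₐ[ℂ] (crossedProduct B α).toStarSubalgebra where
  toFun b := ⟨crossedRep B α b, subset_vonNeumannGenerated _ (.inl ⟨b, rfl⟩)⟩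
  map_one' := by ext; simp
  map_mul' a b := by ext; simp
  map_zero' := by ext; simp
  map_add' a b := by ext; simp
  commutes' r := by ext; simp [Algebra.algebraMap_eq_smul_one]
  map_star' b := Subtype.ext (star_crossedRep B α b).symm

/-- The canonical unitaries `λ(g)` of the crossed product. -/
def crossedUnitary : Γ →* (crossedProduct B α).toStarSubalgebra where
  toFun g := ⟨translation g, subset_vonNeumannGenerated _ (.inr ⟨g, rfl⟩)⟩
  map_one' := Subtype.ext translation_one
  map_mul' g h := Subtype.ext (translation_mul g h)

@[simp]
theorem coe_crossedEmbedding (b : B.toStarSubalgebra) :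
    (crossedEmbedding B α b : EllTwo Γ H →L[ℂ] EllTwo Γ H) = crossedRep B α b := rfl

@[simp]
theorem coe_crossedUnitary (g : Γ) :
    (crossedUnitary B α g : EllTwo Γ H →L[ℂ] EllTwo Γ H) = translation g := rfl

theorem star_crossedUnitary (g : Γ) : star (crossedUnitary B α g) = crossedUnitary B α g⁻¹ :=
  Subtype.ext (star_translation g)

theorem crossedUnitary_mem_unitary (g : Γ) : crossedUnitary B α g ∈ unitary _ := by
  rw [Unitary.mem_iff, star_crossedUnitary, ← map_mul, ← map_mul]
  simp

theorem crossedUnitary_mem_crossedGroupAlgebra (g : Γ) :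
    crossedUnitary B α g ∈ crossedGroupAlgebra B α :=
  subset_vonNeumannGenerated _ ⟨g, rfl⟩

theorem crossedUnitary_mul_crossedEmbedding (g : Γ) (b : B.toStarSubalgebra) :
    crossedUnitary B α g * crossedEmbedding B α b =
      crossedEmbedding B α (α g b) * crossedUnitary B α g := by
  ext f k
  simp [← StarAlgEquiv.mul_apply]

theorem crossedEmbedding_mul_crossedUnitary (b : B.toStarSubalgebra) (g : Γ) :
    crossedEmbedding B α b * crossedUnitary B α g =
      crossedUnitary B α g * crossedEmbedding B α (α g⁻¹ b) := by
  rw [crossedUnitary_mul_crossedEmbedding, starAut_apply_inv_apply]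

theorem crossedMonomial_mul_crossedMonomial (g h : Γ) (b c : B.toStarSubalgebra) :
    crossedUnitary B α g * crossedEmbedding B α b *
        (crossedUnitary B α h * crossedEmbedding B α c) =
      crossedUnitary B α (g * h) * crossedEmbedding B α (α h⁻¹ b * c) := by
  rw [map_mul, map_mul, mul_assoc, ← mul_assoc (crossedEmbedding B α b),
    crossedEmbedding_mul_crossedUnitary, mul_assoc, mul_assoc]

theorem star_crossedMonomial (g : Γ) (b : B.toStarSubalgebra) :
    star (crossedUnitary B α g * crossedEmbedding B α b) =
      crossedUnitary B α g⁻¹ * crossedEmbedding B α (α g (star b)) := by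
  rw [star_mul, ← map_star, star_crossedUnitary, crossedEmbedding_mul_crossedUnitary, inv_inv]

/-- The submonoid of the monomials `λ(g) π(b)`. -/
def crossedMonomials : Submonoid (crossedProduct B α).toStarSubalgebra where
  carrier := {x | ∃ g b, x = crossedUnitary B α g * crossedEmbedding B α b}
  one_mem' := ⟨1, 1, by simp only [map_one, mul_one]⟩
  mul_mem' := by
    rintro _ _ ⟨g, b, rfl⟩ ⟨h, c, rfl⟩
    exact ⟨g * h, α h⁻¹ b * c, crossedMonomial_mul_crossedMonomial B α g h b c⟩

theorem star_mem_crossedMonomials {x : (crossedProduct B α).toStarSubalgebra}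
    (hx : x ∈ crossedMonomials B α) : star x ∈ crossedMonomials B α := by
  obtain ⟨g, b, rfl⟩ := hx
  exact ⟨g⁻¹, α g (star b), star_crossedMonomial B α g b⟩

theorem coe_mem_centralizer_centralizer_crossedMonomials
    (x : (crossedProduct B α).toStarSubalgebra) :
    (x : EllTwo Γ H →L[ℂ] EllTwo Γ H) ∈ Set.centralizer (Set.centralizer (Subtype.val ''
      (crossedMonomials B α : Set (crossedProduct B α).toStarSubalgebra))) := by
  refine vonNeumannGenerated_subset_centralizer_centralizer (Set.union_subset ?_ ?_) ?_ x.2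
  · rintro _ ⟨b, rfl⟩
    exact ⟨_, ⟨1, b, rfl⟩, by simp⟩
  · rintro _ ⟨g, rfl⟩
    exact ⟨_, ⟨g, 1, rfl⟩, by simp⟩
  · rintro _ ⟨s, hs, rfl⟩
    exact ⟨star s, star_mem_crossedMonomials B α hs, rfl⟩

theorem coe_mem_centralizer_centralizer_crossedUnitary
    {a : (crossedProduct B α).toStarSubalgebra} (ha : a ∈ crossedGroupAlgebra B α) :
    (a : EllTwo Γ H →L[ℂ] EllTwo Γ H) ∈ Set.centralizer (Set.centralizer (Subtype.val ''
      (MonoidHom.mrange (crossedUnitary B α) : Set (crossedProduct B α).toStarSubalgebra))) := by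
  refine vonNeumannGenerated_subset_centralizer_centralizer ?_ ?_ ha
  · rintro _ ⟨g, rfl⟩
    exact ⟨_, ⟨g, rfl⟩, rfl⟩
  · rintro _ ⟨_, ⟨g, rfl⟩, rfl⟩
    exact ⟨_, ⟨g⁻¹, rfl⟩, congrArg Subtype.val (star_crossedUnitary B α g).symm⟩

end CrossedProduct

section Density

universe v w

variable [CompleteSpace H] {B : VonNeumannAlgebra H}
  {α : Γ →* (B.toStarSubalgebra ≃⋆ₐ[ℂ] B.toStarSubalgebra)}
  {φ ψ : (crossedProduct B α).toStarSubalgebra → ℂ}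

theorem IsNormalFunctional.eq_of_forall_crossedMonomial (hφ : IsNormalFunctional.{v} φ)
    (hψ : IsNormalFunctional.{w} ψ)
    (h : ∀ g b, φ (crossedUnitary B α g * crossedEmbedding B α b) =
      ψ (crossedUnitary B α g * crossedEmbedding B α b))
    (x : (crossedProduct B α).toStarSubalgebra) : φ x = ψ x :=
  hφ.eq_of_mem_centralizer_centralizer hψ (fun _ => star_mem_crossedMonomials B α)
    (by rintro _ ⟨g, b, rfl⟩; exact h g b)
    (coe_mem_centralizer_centralizer_crossedMonomials B α x)

theorem IsNormalFunctional.eq_of_forall_crossedUnitary (hφ : IsNormalFunctional.{v} φ)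
    (hψ : IsNormalFunctional.{w} ψ)
    (h : ∀ g, φ (crossedUnitary B α g) = ψ (crossedUnitary B α g))
    {a : (crossedProduct B α).toStarSubalgebra} (ha : a ∈ crossedGroupAlgebra B α) : φ a = ψ a :=
  hφ.eq_of_mem_centralizer_centralizer hψ (S := MonoidHom.mrange (crossedUnitary B α))
    (by rintro _ ⟨g, rfl⟩; exact ⟨g⁻¹, (star_crossedUnitary B α g).symm⟩)
    (by rintro _ ⟨g, rfl⟩; exact h g) (coe_mem_centralizer_centralizer_crossedUnitary B α ha)

end Density

end Crossed

section Coefficients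

variable {Γ : Type*} {H : Type*} [NormedAddCommGroup H] [InnerProductSpace ℂ H] [CompleteSpace H]
  [Group Γ] (B : VonNeumannAlgebra H)
  (α : Γ →* (B.toStarSubalgebra ≃⋆ₐ[ℂ] B.toStarSubalgebra))

/-- The Fourier coefficient `b_g ∈ B` of `x = ∑ λ(g) π(b_g)`, the `B`-valued corner of
`λ(g)* x`. -/
def crossedCoeff (g : Γ) : (crossedProduct B α).toStarSubalgebra →ₗ[ℂ] B.toStarSubalgebra where
  toFun x :=
    ⟨unitCorner ((star (crossedUnitary B α g) * x : (crossedProduct B α).toStarSubalgebra) :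
      EllTwo Γ H →L[ℂ] EllTwo Γ H), unitCorner_mem B α (Subtype.prop _)⟩
  map_add' x y := by ext; simp [mul_add]
  map_smul' c x := by ext; simp

theorem crossedCoeff_apply (g : Γ) (x : (crossedProduct B α).toStarSubalgebra) (v : H) :
    (crossedCoeff B α g x : H →L[ℂ] H) v =
      (x : EllTwo Γ H →L[ℂ] EllTwo Γ H) (EllTwo.single 1 v) g := by
  refine (unitCorner_apply_single _ v).trans ?_
  rw [star_crossedUnitary, MulMemClass.coe_mul, coe_crossedUnitary, mul_apply_eq_comp,
    translation_apply, inv_inv, mul_one]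

theorem crossedCoeff_crossedUnitary_mul (g h : Γ) (x : (crossedProduct B α).toStarSubalgebra) :
    crossedCoeff B α g (crossedUnitary B α h * x) = crossedCoeff B α (h⁻¹ * g) x := by
  ext v
  simp [crossedCoeff_apply]

theorem crossedCoeff_mul_crossedEmbedding (g : Γ) (x : (crossedProduct B α).toStarSubalgebra)
    (b : B.toStarSubalgebra) :
    crossedCoeff B α g (x * crossedEmbedding B α b) = crossedCoeff B α g x * b := by
  ext v
  simp [crossedCoeff_apply, crossedRep_single]

open Classical in
theorem crossedCoeff_one (g : Γ) : crossedCoeff B α g 1 = if g = 1 then 1 else 0 := by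
  ext v
  rw [crossedCoeff_apply, OneMemClass.coe_one, one_apply_eq_self, EllTwo.single_apply]
  split_ifs <;> rfl

open Classical in
theorem crossedCoeff_monomial (g h : Γ) (b : B.toStarSubalgebra) :
    crossedCoeff B α g (crossedUnitary B α h * crossedEmbedding B α b) =
      if h = g then b else 0 := by
  rw [crossedCoeff_crossedUnitary_mul, ← one_mul (crossedEmbedding B α b),
    crossedCoeff_mul_crossedEmbedding, crossedCoeff_one, ite_mul, one_mul, zero_mul]
  exact if_congr inv_mul_eq_one rfl rfl

open Classical in
theorem crossedCoeff_crossedUnitary (g h : Γ) :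
    crossedCoeff B α g (crossedUnitary B α h) = if h = g then 1 else 0 := by
  rw [← crossedCoeff_monomial, map_one, mul_one]

end Coefficients

section CrossedTrace

universe v

variable {Γ : Type*} {H : Type*} [NormedAddCommGroup H] [InnerProductSpace ℂ H] [CompleteSpace H]
  [Group Γ] {B : VonNeumannAlgebra H}
  {α : Γ →* (B.toStarSubalgebra ≃⋆ₐ[ℂ] B.toStarSubalgebra)} {τ : B.toStarSubalgebra →ₗ[ℂ] ℂ}

theorem crossedTrace_star_crossedUnitary_mul (g : Γ)
    (x : (crossedProduct B α).toStarSubalgebra) :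
    crossedTrace B α τ (star (crossedUnitary B α g) * x) = τ (crossedCoeff B α g x) := rfl

theorem crossedTrace_apply (x : (crossedProduct B α).toStarSubalgebra) :
    crossedTrace B α τ x = τ (crossedCoeff B α 1 x) := by
  rw [← crossedTrace_star_crossedUnitary_mul, map_one, star_one, one_mul]

theorem crossedTrace_eq_inner {ι : Type*} {η ξ : EllTwo ι H}
    (h : ∀ b : B.toStarSubalgebra, τ b = inner ℂ η (amplify ι b ξ))
    (x : (crossedProduct B α).toStarSubalgebra) :
    crossedTrace B α τ x =
      inner ℂ (EllTwo.mapSingle (1 : Γ) η) (amplify ι x (EllTwo.mapSingle 1 ξ)) := by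
  rw [crossedTrace_apply, h]
  refine (hasSum_inner_amplify _ _ _).unique ((hasSum_inner_amplify _ _ _).congr_fun fun i => ?_)
  rw [crossedCoeff_apply, EllTwo.mapSingle_apply, EllTwo.mapSingle_apply,
    EllTwo.inner_single_left]

theorem isNormalFunctional_crossedTrace (hτ : IsNormalFunctional.{v} τ) :
    IsNormalFunctional.{v} (crossedTrace B α τ) := by
  obtain ⟨ι, η, ξ, h⟩ := hτ
  exact ⟨ι, _, _, crossedTrace_eq_inner h⟩

open Classical in
theorem crossedTrace_monomial (g : Γ) (b : B.toStarSubalgebra) :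
    crossedTrace B α τ (crossedUnitary B α g * crossedEmbedding B α b) =
      if g = 1 then τ b else 0 := by
  rw [crossedTrace_apply, crossedCoeff_monomial, apply_ite τ, map_zero]

theorem crossedTrace_monomial_mul_comm (hτ : IsTracialState τ) (hα : PreservesTrace τ α)
    (g h : Γ) (b c : B.toStarSubalgebra) :
    crossedTrace B α τ (crossedUnitary B α g * crossedEmbedding B α b *
        (crossedUnitary B α h * crossedEmbedding B α c)) =
      crossedTrace B α τ (crossedUnitary B α h * crossedEmbedding B α c *
        (crossedUnitary B α g * crossedEmbedding B α b)) := by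
  classical
  rw [crossedMonomial_mul_crossedMonomial, crossedMonomial_mul_crossedMonomial,
    crossedTrace_monomial, crossedTrace_monomial]
  by_cases hgh : g * h = 1
  · rw [if_pos hgh, if_pos (mul_eq_one_comm.mp hgh), inv_eq_of_mul_eq_one_left hgh,
      ← hα g (α g⁻¹ c * b), map_mul (α g), starAut_apply_inv_apply,
      hτ.tracial]
  · rw [if_neg hgh, if_neg (mul_eq_one_comm.not.mp hgh)]

theorem crossedTrace_mul_comm (hτ : IsTracialState τ) (hτ_normal : IsNormalFunctional.{v} τ)
    (hα : PreservesTrace τ α) (x y : (crossedProduct B α).toStarSubalgebra) :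
    crossedTrace B α τ (x * y) = crossedTrace B α τ (y * x) := by
  have hT := isNormalFunctional_crossedTrace (α := α) hτ_normal
  refine (hT.mul_right y).eq_of_forall_crossedMonomial (hT.mul_left y) (fun g b => ?_) x
  exact (hT.mul_left _).eq_of_forall_crossedMonomial (hT.mul_right _)
    (fun h c => crossedTrace_monomial_mul_comm hτ hα g h b c) y

theorem hasSum_crossedTrace_star_mul_self (hτ : IsNormalFunctional.{v} τ)
    (x : (crossedProduct B α).toStarSubalgebra) :
    HasSum (fun g => τ (star (crossedCoeff B α g x) * crossedCoeff B α g x))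
      (crossedTrace B α τ (star x * x)) := by
  obtain ⟨ι, η, ξ, h⟩ := hτ
  have htrace : crossedTrace B α τ (star x * x) =
      inner ℂ
        (amplify ι (x : EllTwo Γ H →L[ℂ] EllTwo Γ H) (EllTwo.mapSingle (1 : Γ) η))
        (amplify ι (x : EllTwo Γ H →L[ℂ] EllTwo Γ H) (EllTwo.mapSingle (1 : Γ) ξ)) := by
    rw [crossedTrace_eq_inner h, inner_amplify_left]
    rfl
  have hsum := EllTwo.hasSum_inner_prod (amplify ι (x : EllTwo Γ H →L[ℂ] EllTwo Γ H)
    (EllTwo.mapSingle 1 η)) (amplify ι x (EllTwo.mapSingle 1 ξ))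
  rw [htrace]
  refine ((Equiv.prodComm Γ ι).hasSum_iff.mpr hsum).prod_fiberwise fun g => ?_
  rw [h]
  refine (hasSum_inner_amplify _ _ _).congr_fun fun i => ?_
  rw [MulMemClass.coe_mul, mul_apply_eq_comp, StarMemClass.coe_star,
    ContinuousLinearMap.star_eq_adjoint, ContinuousLinearMap.adjoint_inner_right,
    crossedCoeff_apply, crossedCoeff_apply]
  rfl

theorem isTracialState_crossedTrace (hτ : IsTracialState τ) (hτ_normal : IsNormalFunctional.{v} τ)
    (hα : PreservesTrace τ α) : IsTracialState (crossedTrace B α τ) where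
  map_one := by rw [crossedTrace_apply, crossedCoeff_one, if_pos rfl, hτ.map_one]
  nonneg x := (hasSum_crossedTrace_star_mul_self hτ_normal x).nonneg fun _ => hτ.nonneg _
  tracial := crossedTrace_mul_comm hτ hτ_normal hα

theorem hasSum_twoNorm_crossedCoeff_sq (hτ : IsTracialState τ)
    (hτ_normal : IsNormalFunctional.{v} τ) (hα : PreservesTrace τ α)
    (x : (crossedProduct B α).toStarSubalgebra) :
    HasSum (fun g => twoNorm τ (crossedCoeff B α g x) ^ 2)
      (twoNorm (crossedTrace B α τ) x ^ 2) := by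
  simp only [twoNorm_sq hτ.nonneg,
    twoNorm_sq (isTracialState_crossedTrace hτ hτ_normal hα).nonneg]
  exact Complex.hasSum_re (hasSum_crossedTrace_star_mul_self hτ_normal x)

end CrossedTrace

section GroupAlgebra

universe v

variable {Γ : Type*} {H : Type*} [NormedAddCommGroup H] [InnerProductSpace ℂ H] [CompleteSpace H]
  [Group Γ] {B : VonNeumannAlgebra H}
  {α : Γ →* (B.toStarSubalgebra ≃⋆ₐ[ℂ] B.toStarSubalgebra)} {τ : B.toStarSubalgebra →ₗ[ℂ] ℂ}
  {a : (crossedProduct B α).toStarSubalgebra}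

theorem crossedCoeff_eq_smul_one (hτ_one : τ 1 = 1) (hτ_normal : IsNormalFunctional.{v} τ)
    (ha : a ∈ crossedGroupAlgebra B α) (g : Γ) :
    crossedCoeff B α g a = τ (crossedCoeff B α g a) • 1 := by
  ext w
  refine ext_inner_left ℂ fun u => ?_
  have hφ : IsNormalFunctional.{0} fun x : (crossedProduct B α).toStarSubalgebra =>
      inner ℂ u ((crossedCoeff B α g x : H →L[ℂ] H) w) := by
    simp only [crossedCoeff_apply, ← EllTwo.inner_single_left]
    exact isNormalFunctional_inner _ _
  have hψ : IsNormalFunctional.{v} fun x : (crossedProduct B α).toStarSubalgebra =>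
      inner ℂ u w * τ (crossedCoeff B α g x) := by
    simp only [← crossedTrace_star_crossedUnitary_mul]
    exact ((isNormalFunctional_crossedTrace hτ_normal).mul_left _).const_mul _
  refine (hφ.eq_of_forall_crossedUnitary hψ (fun h => ?_) ha).trans ?_
  · rw [crossedCoeff_crossedUnitary]
    split_ifs <;> simp [hτ_one]
  · simp [inner_smul_right, mul_comm]

theorem hasSum_norm_crossedCoeff_sq (hτ : IsTracialState τ)
    (hτ_normal : IsNormalFunctional.{v} τ) (hα : PreservesTrace τ α)
    (ha : a ∈ crossedGroupAlgebra B α) :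
    HasSum (fun g => ‖τ (crossedCoeff B α g a)‖ ^ 2) (twoNorm (crossedTrace B α τ) a ^ 2) := by
  refine (hasSum_twoNorm_crossedCoeff_sq hτ hτ_normal hα a).congr_fun fun g => ?_
  rw [crossedCoeff_eq_smul_one hτ.map_one hτ_normal ha, twoNorm_smul,
    hτ.twoNorm_unitary (one_mem _), mul_one, map_smul, hτ.map_one, smul_eq_mul, mul_one]

theorem eq_zero_of_crossedTrace_star_mul_self_eq_zero (hτ : IsTracialState τ)
    (hτ_normal : IsNormalFunctional.{v} τ) (hα : PreservesTrace τ α)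
    (ha : a ∈ crossedGroupAlgebra B α) (h : crossedTrace B α τ (star a * a) = 0) : a = 0 := by
  have hT := isTracialState_crossedTrace hτ hτ_normal hα
  have hunit (k : Γ) (v : H) :
      (a : EllTwo Γ H →L[ℂ] EllTwo Γ H) (EllTwo.single k v) = 0 := by
    have hau := mul_mem ha (crossedUnitary_mem_crossedGroupAlgebra B α k)
    have hnorm : twoNorm (crossedTrace B α τ) (a * crossedUnitary B α k) = 0 := by
      rw [twoNorm_mul_unitary hT.tracial (crossedUnitary_mem_unitary B α k), twoNorm, h,
        Complex.zero_re, Real.sqrt_zero]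
    have hcoeff := hasSum_norm_crossedCoeff_sq hτ hτ_normal hα hau
    rw [hnorm, zero_pow two_ne_zero, hasSum_zero_iff_of_nonneg fun _ => sq_nonneg _] at hcoeff
    ext g
    have hg : crossedCoeff B α g (a * crossedUnitary B α k) = 0 := by
      have := congrFun hcoeff g
      rw [crossedCoeff_eq_smul_one hτ.map_one hτ_normal hau, norm_eq_zero.mp
        (pow_eq_zero_iff two_ne_zero |>.mp this), zero_smul]
    have := crossedCoeff_apply B α g (a * crossedUnitary B α k) v
    rw [hg, MulMemClass.coe_mul, mul_apply_eq_comp, coe_crossedUnitary, translation_single,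
      mul_one] at this
    exact this.symm
  exact Subtype.ext (EllTwo.continuousLinearMap_ext hunit)

end GroupAlgebra

section Slice

universe u v

variable {Γ : Type*} {I : Type u} {κ : Type v} {H : Type*} [NormedAddCommGroup H]
  [InnerProductSpace ℂ H]

theorem hasSum_norm_inner_hilbertBasis_sq (e : HilbertBasis I ℂ H) (v : H) :
    HasSum (fun i => ‖inner ℂ (e i) v‖ ^ 2) (‖v‖ ^ 2) := by
  simpa only [HilbertBasis.repr_apply_apply, LinearIsometryEquiv.norm_map] using
    EllTwo.hasSum_norm_sq (e.repr v)

theorem hasSum_norm_amplify_rankOne_sq (e : HilbertBasis I ℂ H) (v : H) (f : EllTwo Γ H) :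
    HasSum (fun i => ‖amplify Γ (InnerProductSpace.rankOne ℂ v (e i)) f‖ ^ 2)
      (‖v‖ ^ 2 * ‖f‖ ^ 2) := by
  have hf (g : Γ) := hasSum_norm_inner_hilbertBasis_sq e (f g)
  have hsummable : Summable fun p : Γ × I => ‖inner ℂ (e p.2) (f p.1)‖ ^ 2 := by
    refine (summable_prod_of_nonneg fun p => sq_nonneg _).mpr ⟨fun g => (hf g).summable, ?_⟩
    simpa only [(hf _).tsum_eq] using ellTwo_summable_sq f
  have hprod : HasSum (fun p : Γ × I => ‖inner ℂ (e p.2) (f p.1)‖ ^ 2) (‖f‖ ^ 2) := by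
    rw [← (hsummable.hasSum.prod_fiberwise hf).unique (EllTwo.hasSum_norm_sq f)]
    exact hsummable.hasSum
  refine (((Equiv.prodComm I Γ).hasSum_iff.mpr hprod).mul_left (‖v‖ ^ 2)).prod_fiberwise
    fun i => ?_
  refine (EllTwo.hasSum_norm_sq _).congr_fun fun g => ?_
  rw [amplify_apply, InnerProductSpace.rankOne_apply, norm_smul, mul_pow, mul_comm]
  rfl

theorem hasSum_prod_norm_amplify_rankOne_sq (e : HilbertBasis I ℂ H) (ξ : EllTwo κ H)
    (f : EllTwo Γ H) :
    HasSum (fun p : κ × I => ‖amplify Γ (InnerProductSpace.rankOne ℂ (ξ p.1) (e p.2)) f‖ ^ 2)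
      (‖ξ‖ ^ 2 * ‖f‖ ^ 2) := by
  have hfiber (n : κ) := hasSum_norm_amplify_rankOne_sq e (ξ n) f
  have htotal := (EllTwo.hasSum_norm_sq ξ).mul_right (‖f‖ ^ 2)
  have hsummable := (summable_prod_of_nonneg fun p : κ × I => sq_nonneg
    ‖amplify Γ (InnerProductSpace.rankOne ℂ (ξ p.1) (e p.2)) f‖).mpr
      ⟨fun n => (hfiber n).summable, by simpa only [(hfiber _).tsum_eq] using htotal.summable⟩
  rw [← (hsummable.hasSum.prod_fiberwise hfiber).unique htotal]
  exact hsummable.hasSum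

/-- The operator `ℓ²(Γ, H) → ℓ²(κ × I, ℓ²(Γ, H))` with components `1 ⊗ |ξₙ⟩⟨eᵢ|`; it is
`ξ ⊗ 1` up to the identification of `H` with `ℓ²(I)`. -/
def sliceMap (Γ : Type*) (e : HilbertBasis I ℂ H) (ξ : EllTwo κ H) :
    EllTwo Γ H →L[ℂ] EllTwo (κ × I) (EllTwo Γ H) :=
  LinearMap.mkContinuous
    { toFun := fun f => ⟨fun p => amplify Γ (InnerProductSpace.rankOne ℂ (ξ p.1) (e p.2)) f,
        ellTwo_mem (hasSum_prod_norm_amplify_rankOne_sq e ξ f).summable⟩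
      map_add' := fun f₁ f₂ => lp.ext (funext fun _ => map_add _ f₁ f₂)
      map_smul' := fun c f => lp.ext (funext fun _ => map_smul _ c f) }
    ‖ξ‖ (fun f => by
      refine (sq_le_sq₀ (norm_nonneg _) (by positivity)).mp ?_
      rw [ellTwo_norm_sq, mul_pow]
      exact (hasSum_prod_norm_amplify_rankOne_sq e ξ f).tsum_eq.le)

theorem sliceMap_single_apply (e : HilbertBasis I ℂ H) (ξ : EllTwo κ H) (g : Γ) (v : H)
    (p : κ × I) :
    sliceMap Γ e ξ (EllTwo.single g v) p = inner ℂ (e p.2) v • EllTwo.single g (ξ p.1) := by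
  rw [← map_smul, ← InnerProductSpace.rankOne_apply, ← amplify_single]
  rfl

theorem inner_sliceMap_single_apply (e : HilbertBasis I ℂ H) (η ξ : EllTwo κ H)
    (x : EllTwo Γ H →L[ℂ] EllTwo Γ H) (g h : Γ) (u v : H) (p : κ × I) :
    inner ℂ (sliceMap Γ e η (EllTwo.single g u) p) (x (sliceMap Γ e ξ (EllTwo.single h v) p)) =
      inner ℂ (η p.1) (x (EllTwo.single h (ξ p.1)) g) *
        (inner ℂ u (e p.2) * inner ℂ (e p.2) v) := by
  rw [sliceMap_single_apply, sliceMap_single_apply, map_smul, inner_smul_left,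
    inner_smul_right, EllTwo.inner_single_left, inner_conj_symm]
  ring

variable [CompleteSpace H]

/-- The slice `(id ⊗ ω)(x) ⊗ 1` of an operator `x` on `ℓ²(Γ, H) = ℓ²(Γ) ⊗ H`, where `ω` is the
normal functional `b ↦ ∑ ⟨ηₙ, b ξₙ⟩`. For `ω = τ` it restricts to the conditional expectation of
the crossed product onto `L(Γ)`. -/
def sliceOp (e : HilbertBasis I ℂ H) (η ξ : EllTwo κ H) (x : EllTwo Γ H →L[ℂ] EllTwo Γ H) :
    EllTwo Γ H →L[ℂ] EllTwo Γ H :=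
  (sliceMap Γ e η).adjoint ∘L amplify (κ × I) x ∘L sliceMap Γ e ξ

theorem inner_sliceOp (e : HilbertBasis I ℂ H) (η ξ : EllTwo κ H)
    (x : EllTwo Γ H →L[ℂ] EllTwo Γ H) (f f' : EllTwo Γ H) :
    inner ℂ f (sliceOp e η ξ x f') =
      inner ℂ (sliceMap Γ e η f) (amplify (κ × I) x (sliceMap Γ e ξ f')) := by
  rw [sliceOp, ContinuousLinearMap.comp_apply, ContinuousLinearMap.adjoint_inner_right,
    ContinuousLinearMap.comp_apply]

theorem isNormalFunctional_inner_sliceOp (N : StarSubalgebra ℂ (EllTwo Γ H →L[ℂ] EllTwo Γ H))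
    (e : HilbertBasis I ℂ H) (η ξ : EllTwo κ H) (f f' : EllTwo Γ H) :
    IsNormalFunctional.{max u v} fun x : N =>
      inner ℂ f (sliceOp e η ξ (x : EllTwo Γ H →L[ℂ] EllTwo Γ H) f') :=
  ⟨κ × I, _, _, fun x => inner_sliceOp e η ξ (x : EllTwo Γ H →L[ℂ] EllTwo Γ H) f f'⟩

theorem sliceOp_single_apply (e : HilbertBasis I ℂ H) (η ξ : EllTwo κ H)
    (x : EllTwo Γ H →L[ℂ] EllTwo Γ H) (g h : Γ) (v : H) {c : ℂ}
    (hc : HasSum (fun n => inner ℂ (η n) (x (EllTwo.single h (ξ n)) g)) c) :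
    sliceOp e η ξ x (EllTwo.single h v) g = c • v := by
  refine ext_inner_left ℂ fun u => ?_
  rw [← EllTwo.inner_single_left, inner_sliceOp, inner_smul_right]
  have hsum := (hasSum_inner_amplify (sliceMap Γ e η (EllTwo.single g u))
    (sliceMap Γ e ξ (EllTwo.single h v)) x).congr_fun
      fun p => (inner_sliceMap_single_apply e η ξ x g h u v p).symm
  have hprod := hc.mul (e.hasSum_inner_mul_inner u v) hsum.summable
  exact hsum.unique hprod

end Slice

section ConditionalExpectation

universe u v

variable {Γ : Type*} {I : Type u} {κ : Type v} {H : Type*} [NormedAddCommGroup H]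
  [InnerProductSpace ℂ H] [CompleteSpace H] [Group Γ] {B : VonNeumannAlgebra H}
  {α : Γ →* (B.toStarSubalgebra ≃⋆ₐ[ℂ] B.toStarSubalgebra)} {τ : B.toStarSubalgebra →ₗ[ℂ] ℂ}

theorem sliceOp_crossedMonomial (e : HilbertBasis I ℂ H) {η ξ : EllTwo κ H}
    (h : ∀ b : B.toStarSubalgebra, τ b = inner ℂ η (amplify κ b ξ)) (hα : PreservesTrace τ α)
    (g : Γ) (b : B.toStarSubalgebra) :
    sliceOp e η ξ (translation g * crossedRep B α b) = τ b • translation g := by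
  classical
  refine EllTwo.continuousLinearMap_ext fun k w => lp.ext (funext fun m => ?_)
  have hentry : HasSum (fun n => inner ℂ (η n)
      ((translation g * crossedRep B α b : EllTwo Γ H →L[ℂ] EllTwo Γ H)
        (EllTwo.single k (ξ n)) m)) (if m = g * k then τ b else 0) := by
    simp only [mul_apply_eq_comp, crossedRep_single, translation_single, EllTwo.single_apply]
    split_ifs
    · rw [← hα k⁻¹, h]
      exact hasSum_inner_amplify _ _ _
    · simpa only [inner_zero_right] using hasSum_zero
  rw [sliceOp_single_apply e η ξ _ m k w hentry]
  change _ = τ b • translation g (EllTwo.single k w) m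
  rw [translation_single, EllTwo.single_apply, ite_smul, smul_ite, smul_zero, zero_smul]

theorem sliceOp_mem_vonNeumannGenerated_translation (e : HilbertBasis I ℂ H) {η ξ : EllTwo κ H}
    (h : ∀ b : B.toStarSubalgebra, τ b = inner ℂ η (amplify κ b ξ)) (hα : PreservesTrace τ α)
    (x : (crossedProduct B α).toStarSubalgebra) :
    sliceOp e η ξ (x : EllTwo Γ H →L[ℂ] EllTwo Γ H) ∈
      (vonNeumannGenerated (Set.range (translation : Γ → EllTwo Γ H →L[ℂ] EllTwo Γ H))
        ).toStarSubalgebra := by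
  rw [← SetLike.mem_coe, coe_vonNeumannGenerated]
  intro R hR
  refine ContinuousLinearMap.ext fun f' => ext_inner_left ℂ fun f => ?_
  rw [mul_apply_eq_comp, mul_apply_eq_comp, ← ContinuousLinearMap.adjoint_inner_left]
  refine (isNormalFunctional_inner_sliceOp _ e η ξ _ _).eq_of_forall_crossedMonomial
    (isNormalFunctional_inner_sliceOp _ e η ξ _ _) (fun g b => ?_) x
  rw [MulMemClass.coe_mul, coe_crossedUnitary, coe_crossedEmbedding,
    sliceOp_crossedMonomial e h hα, ContinuousLinearMap.adjoint_inner_left, smul_apply,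
    smul_apply, map_smul]
  rw [← mul_apply_eq_comp R, ← hR _ (Or.inl ⟨g, rfl⟩), mul_apply_eq_comp]

theorem crossedCoeff_sliceOp (e : HilbertBasis I ℂ H) {η ξ : EllTwo κ H}
    (h : ∀ b : B.toStarSubalgebra, τ b = inner ℂ η (amplify κ b ξ))
    {x y : (crossedProduct B α).toStarSubalgebra}
    (hy : (y : EllTwo Γ H →L[ℂ] EllTwo Γ H) = sliceOp e η ξ x) (g : Γ) :
    crossedCoeff B α g y = τ (crossedCoeff B α g x) • 1 := by
  ext w
  rw [crossedCoeff_apply, hy]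
  refine sliceOp_single_apply e η ξ _ g 1 w ?_
  rw [h]
  refine (hasSum_inner_amplify _ _ _).congr_fun fun n => ?_
  rw [crossedCoeff_apply]

theorem exists_isConditionalExpectation (hτ : IsTracialState τ)
    (hτ_normal : IsNormalFunctional.{v} τ) (hα : PreservesTrace τ α) :
    ∃ E, IsConditionalExpectation (crossedTrace B α τ) (crossedGroupAlgebra B α) E := by
  have hT_normal := isNormalFunctional_crossedTrace (α := α) hτ_normal
  have hT := isTracialState_crossedTrace hτ hτ_normal hα
  obtain ⟨κ, η, ξ, h⟩ := hτ_normal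
  obtain ⟨I, e, -⟩ := exists_hilbertBasis ℂ H
  have hmem (x) := sliceOp_mem_vonNeumannGenerated_translation (B := B) (α := α) e h hα x
  refine ⟨fun x => ⟨sliceOp e η ξ (x : EllTwo Γ H →L[ℂ] EllTwo Γ H),
    vonNeumannGenerated_mono Set.subset_union_right (hmem x)⟩,
    fun x => ⟨hmem x, fun a ha => ?_⟩⟩
  refine (hT_normal.mul_left _).eq_of_forall_crossedUnitary (hT_normal.mul_left x)
    (fun g => ?_) ha
  rw [hT.tracial, hT.tracial x, ← inv_inv g, ← star_crossedUnitary,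
    crossedTrace_star_crossedUnitary_mul, crossedTrace_star_crossedUnitary_mul,
    crossedCoeff_sliceOp e h rfl, map_smul, hτ.map_one, smul_eq_mul, mul_one]

end ConditionalExpectation

theorem IsWeaklyMixingAction.of_forall_apply_eq_zero {N Γ : Type*} [Ring N] [StarRing N]
    [Algebra ℂ N] [StarModule ℂ N] [Group Γ] {τ : N →ₗ[ℂ] ℂ} {α : Γ →* (N ≃⋆ₐ[ℂ] N)}
    (hτ : τ 1 = 1) (hα : PreservesTrace τ α)
    (h : ∀ F : Finset N, (∀ a ∈ F, τ a = 0) → ∀ ε : ℝ, 0 < ε →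
      ∃ g, ∀ a ∈ F, ∀ b ∈ F, ‖τ (α g a * b)‖ < ε) : IsWeaklyMixingAction τ α := by
  classical
  intro F ε hε
  obtain ⟨g, hg⟩ := h (F.image fun a => a - τ a • (1 : N))
    (Finset.forall_mem_image.mpr fun a _ => by simp [hτ]) ε hε
  refine ⟨g, fun a ha b hb => ?_⟩
  have hcov : τ (α g a * b) - τ a * τ b = τ (α g (a - τ a • 1) * (b - τ b • 1)) := by
    simp [sub_mul, mul_sub, hα g a, hτ, mul_comm]
  rw [hcov]
  exact hg _ (Finset.mem_image_of_mem _ ha) _ (Finset.mem_image_of_mem _ hb)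

theorem IsConditionalExpectation.apply_mul_conj_mul {M : Type*} [Ring M] [StarRing M]
    [Algebra ℂ M] [StarModule ℂ M] {T : M →ₗ[ℂ] ℂ} {A : StarSubalgebra ℂ M} {E : M → M}
    (hE : IsConditionalExpectation T A E) (hT : ∀ x y, T (x * y) = T (y * x)) {u v : M}
    (hv : v ∈ unitary M) (hvA : v ∈ A) (huA : u ∈ A) {x x' : M} (hx : u * x = x' * u) (y : M) :
    T (u * (E (x * (v * y * star v)) * v)) = T (u * (v * (y * x'))) := by
  calc T (u * (E (x * (v * y * star v)) * v))
      = T (u * x * (v * y)) := by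
        rw [hT, mul_assoc, (hE _).2 _ (mul_mem hvA huA), ← mul_assoc, mul_assoc x,
          mul_assoc (v * y), Unitary.star_mul_self_of_mem hv, mul_one, hT, mul_assoc]
    _ = T (u * (v * (y * x'))) := by
        rw [hx, mul_assoc, hT, mul_assoc, mul_assoc]

/-- Enlarging the group of unitaries only helps, so one may always take all of `U(A)`. -/
theorem isWeaklyMixingIn_iff {M : Type*} [Ring M] [StarRing M] [Algebra ℂ M] [StarModule ℂ M]
    {T : M →ₗ[ℂ] ℂ} {A : StarSubalgebra ℂ M} :
    IsWeaklyMixingIn T A ↔ ∃ E, IsConditionalExpectation T A E ∧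
      ∀ F : Finset M, (∀ x ∈ F, E x = 0) → ∀ ε : ℝ, 0 < ε → ∃ v ∈ unitary M, v ∈ A ∧
        ∀ x ∈ F, ∀ y ∈ F, twoNorm T (E (star x * (v * y * star v))) ≤ ε := by
  constructor
  · rintro ⟨G, hGA, -, E, hE, hmix⟩
    refine ⟨E, hE, fun F hF ε hε => ?_⟩
    obtain ⟨v, hv⟩ := hmix F hF ε hε
    exact ⟨v, v.1.2, hGA v v.2, hv⟩
  · rintro ⟨E, hE, hmix⟩
    let G : Subgroup (unitary M) :=
      { A.toSubmonoid.comap (unitary M).subtype with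
        inv_mem' := fun {v} (hv : (v : M) ∈ A) => show star (v : M) ∈ A from star_mem hv }
    have hconj {v x : M} (hv : v ∈ A) (hx : x ∈ A) : v * x * star v ∈ A :=
      mul_mem (mul_mem hv hx) (star_mem hv)
    refine ⟨G, fun _ => id, fun v x => ⟨fun hx => ?_, hconj v.2⟩, E, hE, fun F hF ε hε => ?_⟩
    · have hx : (v : unitary M) * x * star ((v : unitary M) : M) ∈ A := hx
      have := hconj (star_mem (show ((v : unitary M) : M) ∈ A from v.2)) hx
      rwa [star_star, mul_assoc, mul_assoc, mul_assoc, Unitary.star_mul_self_of_mem v.1.2, mul_one,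
        ← mul_assoc, Unitary.star_mul_self_of_mem v.1.2, one_mul] at this
    · obtain ⟨v, hv, hvA, hle⟩ := hmix F hF ε hε
      exact ⟨⟨⟨v, hv⟩, hvA⟩, hle⟩

section MixingOfAction

universe v

variable {Γ : Type*} {H : Type*} [NormedAddCommGroup H] [InnerProductSpace ℂ H] [CompleteSpace H]
  [Group Γ] {B : VonNeumannAlgebra H}
  {α : Γ →* (B.toStarSubalgebra ≃⋆ₐ[ℂ] B.toStarSubalgebra)} {τ : B.toStarSubalgebra →ₗ[ℂ] ℂ}
  {E : (crossedProduct B α).toStarSubalgebra → (crossedProduct B α).toStarSubalgebra}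
  {a c : (crossedProduct B α).toStarSubalgebra}

theorem apply_crossedCoeff_mul_crossedEmbedding (hτ : τ 1 = 1)
    (hτ_normal : IsNormalFunctional.{v} τ) (ha : a ∈ crossedGroupAlgebra B α) (g : Γ)
    (b : B.toStarSubalgebra) :
    τ (crossedCoeff B α g (a * crossedEmbedding B α b)) = τ (crossedCoeff B α g a) * τ b := by
  rw [crossedCoeff_mul_crossedEmbedding, crossedCoeff_eq_smul_one hτ hτ_normal ha,
    smul_one_mul, map_smul, map_smul, hτ, smul_eq_mul, smul_eq_mul, mul_one]

theorem IsConditionalExpectation.apply_mul_crossedEmbedding_mul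
    (hE : IsConditionalExpectation (crossedTrace B α τ) (crossedGroupAlgebra B α) E)
    (hτ : IsTracialState τ) (hτ_normal : IsNormalFunctional.{v} τ) (hα : PreservesTrace τ α)
    (ha : a ∈ crossedGroupAlgebra B α) (hc : c ∈ crossedGroupAlgebra B α)
    (b : B.toStarSubalgebra) : E (a * crossedEmbedding B α b * c) = τ b • (a * c) := by
  have hT := isTracialState_crossedTrace hτ hτ_normal hα
  refine hE.eq_of_forall_apply_mul_eq
    (fun _ => eq_zero_of_crossedTrace_star_mul_self_eq_zero hτ hτ_normal hα)
    (SMulMemClass.smul_mem _ (mul_mem ha hc)) fun d hd => ?_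
  have hcda := mul_mem (mul_mem hc hd) ha
  calc crossedTrace B α τ (τ b • (a * c) * d)
      = crossedTrace B α τ (c * d * a) * τ b := by
        rw [smul_mul_assoc, map_smul, mul_assoc, hT.tracial, smul_eq_mul, mul_comm]
    _ = crossedTrace B α τ (c * d * a * crossedEmbedding B α b) := by
        rw [crossedTrace_apply, crossedTrace_apply,
          apply_crossedCoeff_mul_crossedEmbedding hτ.map_one hτ_normal hcda]
    _ = crossedTrace B α τ (a * crossedEmbedding B α b * c * d) := by
        rw [mul_assoc _ a, ← hT.tracial, mul_assoc _ c]

theorem IsConditionalExpectation.apply_crossedCoeff_conj_mul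
    (hE : IsConditionalExpectation (crossedTrace B α τ) (crossedGroupAlgebra B α) E)
    (hτ : IsTracialState τ) (hτ_normal : IsNormalFunctional.{v} τ) (hα : PreservesTrace τ α)
    {v : (crossedProduct B α).toStarSubalgebra} (hv : v ∈ unitary _)
    (hvA : v ∈ crossedGroupAlgebra B α) (a b : B.toStarSubalgebra) (g : Γ) :
    τ (crossedCoeff B α g
        (E (crossedEmbedding B α b * (v * crossedEmbedding B α a * star v)) * v)) =
      τ (crossedCoeff B α g v) * τ (α g a * b) := by
  have hcomm : star (crossedUnitary B α g) * crossedEmbedding B α b =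
      crossedEmbedding B α (α g⁻¹ b) * star (crossedUnitary B α g) := by
    rw [star_crossedUnitary, crossedUnitary_mul_crossedEmbedding]
  have hconj := hE.apply_mul_conj_mul (crossedTrace_mul_comm hτ hτ_normal hα) hv hvA
    (star_mem (crossedUnitary_mem_crossedGroupAlgebra B α g)) hcomm (crossedEmbedding B α a)
  rw [← map_mul, crossedTrace_star_crossedUnitary_mul, crossedTrace_star_crossedUnitary_mul,
    apply_crossedCoeff_mul_crossedEmbedding hτ.map_one hτ_normal hvA] at hconj
  rw [hconj, ← hα g (a * _), map_mul, starAut_apply_inv_apply]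

theorem IsConditionalExpectation.hasSum_norm_crossedCoeff_sq_mul
    (hE : IsConditionalExpectation (crossedTrace B α τ) (crossedGroupAlgebra B α) E)
    (hτ : IsTracialState τ) (hτ_normal : IsNormalFunctional.{v} τ) (hα : PreservesTrace τ α)
    {v : (crossedProduct B α).toStarSubalgebra} (hv : v ∈ unitary _)
    (hvA : v ∈ crossedGroupAlgebra B α) (a b : B.toStarSubalgebra) :
    HasSum (fun g => ‖τ (crossedCoeff B α g v)‖ ^ 2 * ‖τ (α g a * b)‖ ^ 2)
      (twoNorm (crossedTrace B α τ)
        (E (crossedEmbedding B α b * (v * crossedEmbedding B α a * star v))) ^ 2) := by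
  rw [← twoNorm_mul_unitary (crossedTrace_mul_comm hτ hτ_normal hα) hv]
  refine (hasSum_norm_crossedCoeff_sq hτ hτ_normal hα (mul_mem (hE _).1 hvA)).congr_fun
    fun g => ?_
  rw [hE.apply_crossedCoeff_conj_mul hτ hτ_normal hα hv hvA, norm_mul, mul_pow]

theorem IsConditionalExpectation.exists_twoNorm_crossedEmbedding_le
    (hE : IsConditionalExpectation (crossedTrace B α τ) (crossedGroupAlgebra B α) E)
    (hτ : IsTracialState τ) (hτ_normal : IsNormalFunctional.{v} τ) (hα : PreservesTrace τ α)
    (hmix : ∀ F : Finset (crossedProduct B α).toStarSubalgebra, (∀ x ∈ F, E x = 0) →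
      ∀ ε : ℝ, 0 < ε → ∃ v ∈ unitary _, v ∈ crossedGroupAlgebra B α ∧ ∀ x ∈ F, ∀ y ∈ F,
        twoNorm (crossedTrace B α τ) (E (star x * (v * y * star v))) ≤ ε)
    {F : Finset B.toStarSubalgebra} (hF : ∀ a ∈ F, τ a = 0) {ε : ℝ} (hε : 0 < ε) :
    ∃ v ∈ unitary (crossedProduct B α).toStarSubalgebra, v ∈ crossedGroupAlgebra B α ∧
      ∀ a ∈ F, ∀ b ∈ F, twoNorm (crossedTrace B α τ)
        (E (crossedEmbedding B α b * (v * crossedEmbedding B α a * star v))) ≤ ε := by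
  classical
  have hF_star (b) (hb : b ∈ F ∪ F.image star) : τ b = 0 := by
    obtain hb | hb := Finset.mem_union.mp hb
    · exact hF b hb
    · obtain ⟨a, ha, rfl⟩ := Finset.mem_image.mp hb
      rw [apply_star_of_nonneg hτ.nonneg, hF a ha, star_zero]
  have hE_zero (x) (hx : x ∈ (F ∪ F.image star).image (crossedEmbedding B α)) : E x = 0 := by
    obtain ⟨b, hb, rfl⟩ := Finset.mem_image.mp hx
    have := hE.apply_mul_crossedEmbedding_mul hτ hτ_normal hα (one_mem _) (one_mem _) b
    rwa [hF_star b hb, zero_smul, one_mul, mul_one] at this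
  obtain ⟨v, hv, hvA, hle⟩ := hmix _ hE_zero ε hε
  refine ⟨v, hv, hvA, fun a ha b hb => ?_⟩
  have := hle (crossedEmbedding B α (star b))
    (Finset.mem_image_of_mem _ (Finset.mem_union_right _ (Finset.mem_image_of_mem _ hb)))
    (crossedEmbedding B α a) (Finset.mem_image_of_mem _ (Finset.mem_union_left _ ha))
  rwa [← map_star, star_star] at this

theorem IsConditionalExpectation.exists_norm_apply_mul_lt
    (hE : IsConditionalExpectation (crossedTrace B α τ) (crossedGroupAlgebra B α) E)
    (hτ : IsTracialState τ) (hτ_normal : IsNormalFunctional.{v} τ) (hα : PreservesTrace τ α)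
    {v : (crossedProduct B α).toStarSubalgebra} (hv : v ∈ unitary _)
    (hvA : v ∈ crossedGroupAlgebra B α) {F : Finset B.toStarSubalgebra} {ε : ℝ} (hε : 0 < ε)
    (hle : ∀ a ∈ F, ∀ b ∈ F, twoNorm (crossedTrace B α τ)
      (E (crossedEmbedding B α b * (v * crossedEmbedding B α a * star v))) ≤ ε / (F.card + 1)) :
    ∃ g, ∀ a ∈ F, ∀ b ∈ F, ‖τ (α g a * b)‖ < ε := by
  have hweights := hasSum_norm_crossedCoeff_sq hτ hτ_normal hα hvA
  rw [(isTracialState_crossedTrace hτ hτ_normal hα).twoNorm_unitary hv, one_pow] at hweights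
  have hsum (p : B.toStarSubalgebra × B.toStarSubalgebra) :=
    hE.hasSum_norm_crossedCoeff_sq_mul hτ hτ_normal hα hv hvA p.1 p.2
  have hbound (p) (hp : p ∈ F ×ˢ F) : twoNorm (crossedTrace B α τ)
      (E (crossedEmbedding B α p.2 * (v * crossedEmbedding B α p.1 * star v))) ^ 2 ≤
      (ε / (F.card + 1)) ^ 2 :=
    pow_le_pow_left₀ (twoNorm_nonneg _)
      (hle _ (Finset.mem_product.mp hp).1 _ (Finset.mem_product.mp hp).2) 2
  have hcard : ∑ _p ∈ F ×ˢ F, (ε / (F.card + 1)) ^ 2 < ε ^ 2 := by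
    rw [Finset.sum_const, Finset.card_product, nsmul_eq_mul, div_pow, ← mul_div_assoc,
      div_lt_iff₀ (by positivity), mul_comm]
    push_cast
    gcongr
    nlinarith [(F.card.cast_nonneg : (0 : ℝ) ≤ F.card)]
  obtain ⟨g, hg⟩ := exists_forall_lt_of_hasSum (fun _ => sq_nonneg _) hweights
    (fun _ _ => sq_nonneg _) (fun p _ => hsum p) ((Finset.sum_le_sum hbound).trans_lt hcard)
  exact ⟨g, fun a ha b hb =>
    lt_of_pow_lt_pow_left₀ 2 hε.le (hg (a, b) (Finset.mk_mem_product ha hb))⟩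

theorem IsWeaklyMixingIn.isWeaklyMixingAction
    (h : IsWeaklyMixingIn (crossedTrace B α τ) (crossedGroupAlgebra B α))
    (hτ : IsTracialState τ) (hτ_normal : IsNormalFunctional.{v} τ) (hα : PreservesTrace τ α) :
    IsWeaklyMixingAction τ α := by
  obtain ⟨E, hE, hmix⟩ := isWeaklyMixingIn_iff.mp h
  refine .of_forall_apply_eq_zero hτ.map_one hα fun F hF ε hε => ?_
  obtain ⟨v, hv, hvA, hle⟩ := hE.exists_twoNorm_crossedEmbedding_le hτ hτ_normal hα hmix hF
    (ε := ε / (F.card + 1)) (by positivity)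
  exact hE.exists_norm_apply_mul_lt hτ hτ_normal hα hv hvA hε hle

end MixingOfAction

theorem isWeaklyMixingIn_of_tendsto {M : Type*} [CStarAlgebra M] {T : M →ₗ[ℂ] ℂ}
    {A : StarSubalgebra ℂ M} {E : M → M} (hE : IsConditionalExpectation T A E)
    (hA : ∀ a ∈ A, T (star a * a) = 0 → a = 0) (hT : IsTracialState T) {D : Set M}
    (hD : ∀ x, E x = 0 → x ∈ twoNormClosure T (AddSubmonoid.closure D))
    {ι : Type*} {l : Filter ι} [l.NeBot] {v : ι → M} (hv : ∀ i, v i ∈ unitary M)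
    (hvA : ∀ i, v i ∈ A)
    (hlim : ∀ x ∈ D, ∀ y ∈ D,
      Tendsto (fun i => twoNorm T (E (star x * (v i * y * star (v i))))) l (𝓝 0)) :
    IsWeaklyMixingIn T A := by
  refine isWeaklyMixingIn_iff.mpr ⟨E, hE, fun F hF ε hε => ?_⟩
  let σ i : M ≃⋆ₐ[ℂ] M := Unitary.conjStarAlgAut ℂ M ⟨v i, hv i⟩
  have hσ i x : T (σ i x) = T x := by
    rw [Unitary.conjStarAlgAut_apply, hT.tracial, ← mul_assoc, Unitary.star_mul_self_of_mem (hv i),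
      one_mul]
  have hσ_apply i x : σ i x = v i * x * star (v i) := Unitary.conjStarAlgAut_apply _ _
  simp only [← hσ_apply] at hlim ⊢
  have hlim' x (hx : x ∈ F) y (hy : y ∈ F) :
      Tendsto (fun i => twoNorm T (E (star x * σ i y))) l (𝓝 0) :=
    hE.tendsto_twoNorm_star_mul_of_mem_twoNormClosure hA hT hσ
      (fun _ h _ h' => hE.tendsto_twoNorm_star_mul_of_mem_closure hA hT.nonneg hlim h h')
      (hD x (hF x hx)) (hD y (hF y hy))
  have hevent : ∀ᶠ i in l, ∀ x ∈ F, ∀ y ∈ F, twoNorm T (E (star x * σ i y)) ≤ ε :=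
    F.eventually_all.mpr fun x hx => F.eventually_all.mpr fun y hy =>
      (hlim' x hx y hy).eventually_le_const hε
  obtain ⟨i, hi⟩ := hevent.exists
  exact ⟨v i, hv i, hvA i, hi⟩

section ActionOfMixing

universe v

variable {Γ : Type*} {H : Type*} [NormedAddCommGroup H] [InnerProductSpace ℂ H] [CompleteSpace H]
  [Group Γ] {B : VonNeumannAlgebra H}
  {α : Γ →* (B.toStarSubalgebra ≃⋆ₐ[ℂ] B.toStarSubalgebra)} {τ : B.toStarSubalgebra →ₗ[ℂ] ℂ}
  {E : (crossedProduct B α).toStarSubalgebra → (crossedProduct B α).toStarSubalgebra}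

theorem star_crossedMonomial_mul_conj (g k p : Γ) (b c : B.toStarSubalgebra) :
    star (crossedUnitary B α g * crossedEmbedding B α b) *
        (crossedUnitary B α p * (crossedUnitary B α k * crossedEmbedding B α c) *
          star (crossedUnitary B α p)) =
      crossedUnitary B α g⁻¹ * crossedEmbedding B α (α g (star b) * α p (α k c)) *
        crossedUnitary B α (p * k * p⁻¹) := by
  rw [star_crossedMonomial, crossedUnitary_mul_crossedEmbedding B α k,
    ← mul_assoc _ _ (crossedUnitary B α k), crossedUnitary_mul_crossedEmbedding B α p,
    star_crossedUnitary, map_mul (crossedEmbedding B α), map_mul, map_mul]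
  simp only [mul_assoc]

theorem IsConditionalExpectation.twoNorm_star_crossedMonomial_mul_conj
    (hE : IsConditionalExpectation (crossedTrace B α τ) (crossedGroupAlgebra B α) E)
    (hτ : IsTracialState τ) (hτ_normal : IsNormalFunctional.{v} τ) (hα : PreservesTrace τ α)
    (g k p : Γ) (b c : B.toStarSubalgebra) :
    twoNorm (crossedTrace B α τ) (E (star (crossedUnitary B α g * crossedEmbedding B α b) *
        (crossedUnitary B α p * (crossedUnitary B α k * crossedEmbedding B α c) *
          star (crossedUnitary B α p)))) =
      ‖τ (α p (α k c) * α g (star b))‖ := by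
  have hT := isTracialState_crossedTrace hτ hτ_normal hα
  rw [star_crossedMonomial_mul_conj, hE.apply_mul_crossedEmbedding_mul hτ hτ_normal hα
    (crossedUnitary_mem_crossedGroupAlgebra B α _) (crossedUnitary_mem_crossedGroupAlgebra B α _),
    twoNorm_smul, hT.twoNorm_unitary (mul_mem (crossedUnitary_mem_unitary B α _)
      (crossedUnitary_mem_unitary B α _)), mul_one, hτ.tracial]

theorem IsConditionalExpectation.apply_crossedCoeff_eq_zero
    (hE : IsConditionalExpectation (crossedTrace B α τ) (crossedGroupAlgebra B α) E)
    (hτ : IsTracialState τ) (hτ_normal : IsNormalFunctional.{v} τ) (hα : PreservesTrace τ α)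
    {x : (crossedProduct B α).toStarSubalgebra} (hx : E x = 0) (g : Γ) :
    τ (crossedCoeff B α g x) = 0 := by
  rw [← crossedTrace_star_crossedUnitary_mul, crossedTrace_mul_comm hτ hτ_normal hα,
    ← (hE x).2 _ (star_mem (crossedUnitary_mem_crossedGroupAlgebra B α g)), hx, zero_mul, map_zero]

theorem twoNorm_sub_sum_crossedMonomial_sq (hτ : IsTracialState τ)
    (hτ_normal : IsNormalFunctional.{v} τ) (hα : PreservesTrace τ α)
    (x : (crossedProduct B α).toStarSubalgebra) (s : Finset Γ) :
    twoNorm (crossedTrace B α τ)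
        (x - ∑ g ∈ s, crossedUnitary B α g * crossedEmbedding B α (crossedCoeff B α g x)) ^ 2 =
      twoNorm (crossedTrace B α τ) x ^ 2 - ∑ g ∈ s, twoNorm τ (crossedCoeff B α g x) ^ 2 := by
  classical
  have hcoeff (h : Γ) : crossedCoeff B α h
      (x - ∑ g ∈ s, crossedUnitary B α g * crossedEmbedding B α (crossedCoeff B α g x)) =
      if h ∈ s then 0 else crossedCoeff B α h x := by
    simp only [map_sub, map_sum, crossedCoeff_monomial, Finset.sum_ite_eq']
    split_ifs <;> simp
  have hsum := (hasSum_twoNorm_crossedCoeff_sq hτ hτ_normal hα x).sub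
    (hasSum_sum_of_ne_finset_zero (f := fun h =>
      if h ∈ s then twoNorm τ (crossedCoeff B α h x) ^ 2 else 0) fun h hh => if_neg hh)
  rw [Finset.sum_ite_mem, Finset.inter_self] at hsum
  refine (hasSum_twoNorm_crossedCoeff_sq hτ hτ_normal hα _).unique (hsum.congr_fun fun h => ?_)
  rw [hcoeff]
  split_ifs <;> simp [twoNorm_zero]

theorem mem_twoNormClosure_crossedMonomial (hτ : IsTracialState τ)
    (hτ_normal : IsNormalFunctional.{v} τ) (hα : PreservesTrace τ α)
    {x : (crossedProduct B α).toStarSubalgebra} {N : Set B.toStarSubalgebra}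
    (hx : ∀ g, crossedCoeff B α g x ∈ N) :
    x ∈ twoNormClosure (crossedTrace B α τ) (AddSubmonoid.closure
      {y | ∃ g, ∃ b ∈ N, crossedUnitary B α g * crossedEmbedding B α b = y}) := by
  have hlim : Tendsto (fun s => twoNorm (crossedTrace B α τ)
      (x - ∑ g ∈ s, crossedUnitary B α g * crossedEmbedding B α (crossedCoeff B α g x)) ^ 2)
      atTop (𝓝 0) := by
    simp only [twoNorm_sub_sum_crossedMonomial_sq hτ hτ_normal hα]
    rw [← sub_self (twoNorm (crossedTrace B α τ) x ^ 2)]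
    exact (hasSum_twoNorm_crossedCoeff_sq hτ hτ_normal hα x).const_sub
      (twoNorm (crossedTrace B α τ) x ^ 2)
  intro ε hε
  obtain ⟨s, hs⟩ := (hlim.eventually_lt_const (pow_pos hε 2)).exists
  exact ⟨_, sum_mem fun g _ => AddSubmonoid.subset_closure ⟨g, _, hx g, rfl⟩,
    lt_of_pow_lt_pow_left₀ 2 hε.le hs⟩

theorem IsWeaklyMixingAction.isWeaklyMixingIn (h : IsWeaklyMixingAction τ α)
    (hτ : IsTracialState τ) (hτ_normal : IsNormalFunctional.{v} τ) (hα : PreservesTrace τ α) :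
    IsWeaklyMixingIn (crossedTrace B α τ) (crossedGroupAlgebra B α) := by
  classical
  obtain ⟨E, hE⟩ := exists_isConditionalExpectation hτ hτ_normal hα
  obtain ⟨p, hp⟩ := h.exists_tendsto
  have := isClosed_vonNeumannAlgebra (crossedProduct B α)
  refine isWeaklyMixingIn_of_tendsto (l := atTop) hE
    (fun _ => eq_zero_of_crossedTrace_star_mul_self_eq_zero hτ hτ_normal hα)
    (isTracialState_crossedTrace hτ hτ_normal hα)
    (fun x hx => mem_twoNormClosure_crossedMonomial hτ hτ_normal hα (N := {b | τ b = 0})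
      (hE.apply_crossedCoeff_eq_zero hτ hτ_normal hα hx))
    (fun i => crossedUnitary_mem_unitary B α (p i))
    (fun i => crossedUnitary_mem_crossedGroupAlgebra B α (p i)) ?_
  rintro _ ⟨g, b, -, rfl⟩ _ ⟨k, c, hc, rfl⟩
  simp only [hE.twoNorm_star_crossedMonomial_mul_conj hτ hτ_normal hα]
  have hc' : τ (α k c) = 0 := (hα k c).trans hc
  simpa [hc'] using (hp (α k c) (α g (star b))).norm

end ActionOfMixing

section NormalFaithfulTrace

variable {H : Type*} [NormedAddCommGroup H] [InnerProductSpace ℂ H] [CompleteSpace H]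
  {B : VonNeumannAlgebra H} {τ : B.toStarSubalgebra →ₗ[ℂ] ℂ}

theorem IsNormalFaithfulTrace.isTracialState (hτ : IsNormalFaithfulTrace B τ) :
    IsTracialState τ :=
  ⟨hτ.map_one, hτ.nonneg, hτ.tracial⟩

theorem IsNormalFaithfulTrace.isNormalFunctional (hτ : IsNormalFaithfulTrace B τ) :
    IsNormalFunctional.{0} τ := by
  obtain ⟨ξ, η, hξ, hη, h⟩ := hτ.normal
  exact ⟨ℕ, ⟨η, ellTwo_mem hη⟩, ⟨ξ, ellTwo_mem hξ⟩,
    fun x => (h x).unique (hasSum_inner_amplify _ _ _)⟩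

end NormalFaithfulTrace

theorem proposition2p2_general.{v} {H : Type*} [NormedAddCommGroup H] [InnerProductSpace ℂ H]
    [CompleteSpace H] {Γ : Type*} [Group Γ] {B : VonNeumannAlgebra H}
    {τ : B.toStarSubalgebra →ₗ[ℂ] ℂ} (hτ : IsTracialState τ)
    (hτ_normal : IsNormalFunctional.{v} τ)
    {α : Γ →* (B.toStarSubalgebra ≃⋆ₐ[ℂ] B.toStarSubalgebra)} (hα : PreservesTrace τ α) :
    IsWeaklyMixingIn (crossedTrace B α τ) (crossedGroupAlgebra B α) ↔
      IsWeaklyMixingAction τ α :=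
  ⟨fun h => h.isWeaklyMixingAction hτ hτ_normal hα, fun h => h.isWeaklyMixingIn hτ hτ_normal hα⟩

end

theorem proposition2p2 {H : Type*} [NormedAddCommGroup H] [InnerProductSpace ℂ H] [CompleteSpace H]
    {Γ₀ : Type*} [CommGroup Γ₀]
    (B : VonNeumannAlgebra H)
    (τ : B.toStarSubalgebra →ₗ[ℂ] ℂ) (hτ : IsNormalFaithfulTrace B τ)
    (α : Γ₀ →* (B.toStarSubalgebra ≃⋆ₐ[ℂ] B.toStarSubalgebra)) (hα : PreservesTrace τ α) :
    IsWeaklyMixingIn (crossedTrace B α τ) (crossedGroupAlgebra B α) ↔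
      IsWeaklyMixingAction τ α :=
  proposition2p2_general hτ.isTracialState hτ.isNormalFunctional hα
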